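/- **Setting.** Let $I=[0,1]$, $d\in\mathbb N$, and let $\tau:I\to I$ be piecewise $C^2$, piecewise onto and uniformly expanding: there are $\alpha>1$ and $0=\xi_0<\dots<\xi_M=1$ such that on each $(\xi_{i-1},\xi_i)$ the map $\tau$ is monotone, has a $C^2$ extension to $[\xi_{i-1},\xi_i]$ mapping that interval onto $I$, and $|\tau'|\ge\alpha$. Let $V=\{\pm e_1,\dots,\pm e_d\}\subset\mathbb Z^d$. For $0<\varepsilon\le\varepsilon_0$ and $v\in V$ let $A_{\varepsilon,v}\subset I$ be an open interval of length $\varepsilon$, such that $A_{\delta,v}\cap A_{\varepsilon,w}=\emptyset$ whenever $0<\delta\le\varepsilon\le\varepsilon_0$ and $v\ne w$ (so for each $\varepsilon$ the intervals are disjoint; the case $\delta<\varepsilon$ is automatic if $A_{\delta,v}\subset A_{\varepsilon,v}$). Fix a site $p^*\in\mathbb Z^d$. For $0<\delta\le\varepsilon\le\varepsilon_0$ put $r(p,q)=\delta$ if $p^*\in\{p,q\}$ and $r(p,q)=\varepsilon$ otherwise, and for $x\in I^{\mathbb Z^d}$ let $$(\Phi_{\varepsilon,\delta}(x))_p=\begin{cases}x_{p+v}&\text{if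 } x_p\in A_{r(p,p+v),v}\text{ and }x_{p+v}\in A_{r(p,p+v),-v}\text{ for some }v\in V,\\ x_p&\text{otherwise.}\end{cases}$$ The fully coupled map is $T_{\varepsilon,\delta}=T_0\circ\Phi_{\varepsilon,\delta}$, where $(T_0x)_p=\tau(x_p)$. Let $\mathcal D$ be the space of complex-valued functions on $I^{\mathbb Z^d}$ that depend on finitely many coordinates and are $C^1$ in them, and $\mathcal D_1=\{\varphi\in\mathcal D:|\varphi|_\infty\le1\}$. For a complex Borel measure $\mu$ on $I^{\mathbb Z^d}$ (product topology) let $$|\mu|=\sup_{\varphi\in\mathcal D_1}|\mu(\varphi)|,\qquad \|\mu\|=\sup_{p\in\mathbb Z^d}\ \sup_{\varphi\in\mathcal D_1}|\mu(\partial_p\varphi)|,\qquad \mathcal B=\{\mu:\|\mu\|<\infty\}.$$ **Weight.** Let $\Lambda\subset\mathbb Z^d$ be finite, $s\ge1$, and $a_1,\dots,a_s\in[-1,1]$ with $a_1\in\{0,1\}$. For $0<\delta\le\varepsilon_0$ let $A_1(\delta),\dots,A_s(\delta)\subset I^\Lambda$ be products of subintervals of $I$, and let $h_\delta=\sum_{i=1}^s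 a_i1_{A_i(\delta)}$. Assume that $|h_\delta|\le1$ everywhere (automatic if the $A_i(\delta)$ are pairwise disjoint), and that for all $0<\delta'\le\delta\le\varepsilon_0$ $$\{h_\delta=a_1\}\subset\{h_{\delta'}=a_1\},\qquad \{h_{\delta'}=a_i\}\subset\{h_\delta=a_i\}\ \text{ for every } i \text{ with } a_i\ne a_1 .$$ Let $g_\delta(x)=h_\delta(x_\Lambda)$, and let $\mathcal L_{\varepsilon,g_\delta}$ be the operator on complex Borel measures defined by $$\int\varphi\,d(\mathcal L_{\varepsilon,g_\delta}\mu)=\int(\varphi\circ T_{\varepsilon,\delta})\,g_\delta\,d\mu ,$$ that is, $\mathcal L_{\varepsilon,g_\delta}=\mathcal L_{\varepsilon,\delta}(g_\delta\,\cdot)$ with $\mathcal L_{\varepsilon,\delta}$ the transfer operator of $T_{\varepsilon,\delta}$. **Proposition.** There are $\sigma\in(0,1)$ and $C>0$, independent of $\varepsilon$ and $\delta$, such that for all $0<\delta\le\varepsilon\le\varepsilon_0$, all $n\in\mathbb N$ and all $\mu\in\mathcal B$, $$\|\mathcal L_{\varepsilon,g_\delta}^n\mu\|\le C\sigma^n\|\mu\|+C|\mu|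 .$$ -/

import Mathlib

open MeasureTheory Set
open scoped ENNReal

noncomputable section

namespace CoupledLattice

/-- Sites of the lattice `ℤ^d`. -/
abbrev Site (d : ℕ) : Type := Fin d → ℤ

/-- The phase space `I^{ℤ^d}`, `I = [0,1]`, with the product topology and product σ-algebra
(which is the Borel σ-algebra, since `ℤ^d` is countable). -/
abbrev Config (d : ℕ) : Type := Site d → unitInterval

/-- `τ : I → I` is piecewise `C²`, piecewise onto and uniformly expanding: on each open interval
`(ξ i, ξ (i+1))` of a finite partition of `[0,1]` it agrees with a monotone function `f` which is
`C²` on `[ξ i, ξ (i+1)]`, maps that interval onto `[0,1]` and satisfies `|f'| ≥ α > 1`.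
The values of `τ` at the partition points are arbitrary. -/
def IsPiecewiseExpanding (τ : unitInterval → unitInterval) : Prop :=
  ∃ α : ℝ, 1 < α ∧ ∃ (M : ℕ) (ξ : Fin (M + 1) → ℝ),
    StrictMono ξ ∧ ξ 0 = 0 ∧ ξ (Fin.last M) = 1 ∧
    ∀ i : Fin M, ∃ f : ℝ → ℝ,
      ContDiffOn ℝ 2 f (Icc (ξ i.castSucc) (ξ i.succ)) ∧
      (MonotoneOn f (Icc (ξ i.castSucc) (ξ i.succ)) ∨
        AntitoneOn f (Icc (ξ i.castSucc) (ξ i.succ))) ∧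
      f '' Icc (ξ i.castSucc) (ξ i.succ) = Icc 0 1 ∧
      (∀ x ∈ Icc (ξ i.castSucc) (ξ i.succ),
        α ≤ |derivWithin f (Icc (ξ i.castSucc) (ξ i.succ)) x|) ∧
      ∀ x : unitInterval, (x : ℝ) ∈ Ioo (ξ i.castSucc) (ξ i.succ) → (τ x : ℝ) = f x

/-- The set `V` of the `2d` directions `±e_i`. -/
def directions (d : ℕ) : Set (Site d) :=
  {v | ∃ i : Fin d, v = Pi.single i 1 ∨ v = -Pi.single i 1}

/-- The collision intervals `A_{ε,v} = (left ε v, left ε v + ε) ⊆ [0,1]`, for `0 < ε ≤ ε₀` and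
`v ∈ V`. Intervals of distinct directions are disjoint, also when two sizes `δ ≤ ε` are mixed
(which is automatic when `A_{δ,v} ⊆ A_{ε,v}`, for instance when the midpoint of `A_{ε,v}` does not
depend on `ε`); this makes the coupling with two sizes well defined. -/
structure CollisionIntervals (d : ℕ) where
  ε₀ : ℝ
  ε₀_pos : 0 < ε₀
  left : ℝ → Site d → ℝ
  left_nonneg : ∀ ε, 0 < ε → ε ≤ ε₀ → ∀ v ∈ directions d, 0 ≤ left ε v
  right_le_one : ∀ ε, 0 < ε → ε ≤ ε₀ → ∀ v ∈ directions d, left ε v + ε ≤ 1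
  disjoint : ∀ δ ε, 0 < δ → δ ≤ ε → ε ≤ ε₀ → ∀ v ∈ directions d, ∀ w ∈ directions d, v ≠ w →
    Disjoint (Ioo (left δ v) (left δ v + δ)) (Ioo (left ε w) (left ε w + ε))

/-- The set `A_{ε,v} ⊆ I`. -/
def CollisionIntervals.interval {d : ℕ} (A : CollisionIntervals d) (ε : ℝ) (v : Site d) :
    Set unitInterval :=
  {t | A.left ε v < (t : ℝ) ∧ (t : ℝ) < A.left ε v + ε}

/-- The size of the intervals which govern the collision of the sites `p` and `q`:
`δ` if one of them is the distinguished site `pstar`, and `ε` otherwise. -/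
def zoneSize {d : ℕ} (pstar : Site d) (ε δ : ℝ) (p q : Site d) : ℝ :=
  open Classical in if p = pstar ∨ q = pstar then δ else ε

/-- In the configuration `x`, the site `p` collides with its neighbour `p + v`. -/
def Collides {d : ℕ} (A : CollisionIntervals d) (pstar : Site d) (ε δ : ℝ)
    (x : Config d) (p v : Site d) : Prop :=
  v ∈ directions d ∧ x p ∈ A.interval (zoneSize pstar ε δ p (p + v)) v ∧
    x (p + v) ∈ A.interval (zoneSize pstar ε δ p (p + v)) (-v)

/-- For admissible sizes, the direction in which a site collides is unique. -/
theorem Collides.unique {d : ℕ} {A : CollisionIntervals d} {pstar : Site d} {ε δ : ℝ}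
    (hδ : 0 < δ) (hδε : δ ≤ ε) (hε : ε ≤ A.ε₀) {x : Config d} {p v w : Site d}
    (hv : Collides A pstar ε δ x p v) (hw : Collides A pstar ε δ x p w) : v = w := by
  by_contra hne
  obtain ⟨hv1, hv2, -⟩ := hv
  obtain ⟨hw1, hw2, -⟩ := hw
  have key : ∀ r r' : ℝ, (r = ε ∨ r = δ) → (r' = ε ∨ r' = δ) →
      Disjoint (Ioo (A.left r v) (A.left r v + r)) (Ioo (A.left r' w) (A.left r' w + r')) := by
    rintro r r' (rfl | rfl) (rfl | rfl)
    · exact A.disjoint _ _ (hδ.trans_le hδε) le_rfl hε v hv1 w hw1 hne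
    · exact (A.disjoint _ _ hδ hδε hε w hw1 v hv1 (Ne.symm hne)).symm
    · exact A.disjoint _ _ hδ hδε hε v hv1 w hw1 hne
    · exact A.disjoint _ _ hδ le_rfl (hδε.trans hε) v hv1 w hw1 hne
  have hz : ∀ q, zoneSize pstar ε δ p q = ε ∨ zoneSize pstar ε δ p q = δ := by
    intro q
    unfold zoneSize
    split_ifs
    · exact Or.inr rfl
    · exact Or.inl rfl
  exact Set.disjoint_left.1 (key _ _ (hz (p + v)) (hz (p + w))) hv2 hw2

/-- The coupling `Φ_{ε,δ}`: colliding neighbours exchange their states. For `0 < δ ≤ ε ≤ ε₀` the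
direction of the collision is unique, see `Collides.unique`. -/
def coupling {d : ℕ} (A : CollisionIntervals d) (pstar : Site d) (ε δ : ℝ)
    (x : Config d) : Config d := fun p =>
  open Classical in
    if h : ∃ v, Collides A pstar ε δ x p v then x (p + h.choose) else x p

/-- The fully coupled map `T_{ε,δ} = T_0 ∘ Φ_{ε,δ}`, where `T_0` applies `τ` at every site. -/
def coupledMap {d : ℕ} (τ : unitInterval → unitInterval) (A : CollisionIntervals d)
    (pstar : Site d) (ε δ : ℝ) (x : Config d) : Config d :=
  fun p => τ (coupling A pstar ε δ x p)

/-- The function `φ` as a function of the real coordinate `t = x_p ∈ [0,1]`, the other coordinates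
being those of `x`. -/
def slice {d : ℕ} (φ : Config d → ℂ) (p : Site d) (x : Config d) : ℝ → ℂ :=
  fun t => φ (Function.update x p (projIcc 0 1 zero_le_one t))

/-- The partial derivative `∂_p φ` (one-sided when `x_p` is `0` or `1`). -/
def partialDeriv {d : ℕ} (p : Site d) (φ : Config d → ℂ) (x : Config d) : ℂ :=
  derivWithin (slice φ p x) (Icc 0 1) (x p : ℝ)

/-- The space `𝒟` of functions which depend on finitely many coordinates and are continuously
differentiable in them (up to the boundary of the cube). -/
def IsLocalC1 {d : ℕ} (φ : Config d → ℂ) : Prop :=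
  (∃ S : Finset (Site d), DependsOn φ (S : Set (Site d))) ∧ Continuous φ ∧
    ∀ p, (∀ x, DifferentiableWithinAt ℝ (slice φ p x) (Icc 0 1) (x p : ℝ)) ∧
      Continuous (partialDeriv p φ)

/-- The set `𝒟₁ = {φ ∈ 𝒟 : |φ|_∞ ≤ 1}`. -/
def unitTests (d : ℕ) : Set (Config d → ℂ) :=
  {φ | IsLocalC1 φ ∧ ∀ x, ‖φ x‖ ≤ 1}

/-- `μ(φ) = ∫ φ dμ` for a complex measure `μ`. -/
def pair {d : ℕ} (μ : ComplexMeasure (Config d)) (φ : Config d → ℂ) : ℂ :=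
  μ.integral φ (ContinuousLinearMap.mul ℝ ℂ)

/-- The weak norm `|μ| = sup_{φ ∈ 𝒟₁} |μ(φ)|`. -/
def weakNorm {d : ℕ} (μ : ComplexMeasure (Config d)) : ℝ≥0∞ :=
  ⨆ φ ∈ unitTests d, ‖pair μ φ‖ₑ

/-- The strong norm `‖μ‖ = sup_p sup_{φ ∈ 𝒟₁} |μ(∂_p φ)|`, possibly infinite. -/
def strongNorm {d : ℕ} (μ : ComplexMeasure (Config d)) : ℝ≥0∞ :=
  ⨆ p : Site d, ⨆ φ ∈ unitTests d, ‖pair μ (partialDeriv p φ)‖ₑ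

/-- The space `ℬ` of complex measures of finite strong norm. -/
def bvMeasures (d : ℕ) : Set (ComplexMeasure (Config d)) :=
  {μ | strongNorm μ < ∞}

/-- The weighted transfer operator `μ ↦ T_*(g μ)`, that is `(∫ φ d(L μ)) = ∫ (φ ∘ T) g dμ`;
see `pair_transfer`. -/
def transfer {d : ℕ} (T : Config d → Config d) (g : Config d → ℝ)
    (μ : ComplexMeasure (Config d)) : ComplexMeasure (Config d) :=
  (μ.withDensity g (ContinuousLinearMap.lsmul ℝ ℝ)).map T

/-- The function `h = ∑ i, a i • 1_{A i}` on `I^Λ`, where `A i = ∏_{q ∈ Λ} J i q`. -/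
def stepFunction {d s : ℕ} {Λ : Finset (Site d)} (a : Fin s → ℝ)
    (J : Fin s → Λ → Set unitInterval) (y : Λ → unitInterval) : ℝ :=
  ∑ i, (univ.pi (J i)).indicator (fun _ => a i) y

/-- The local weight `g(x) = h(x_Λ)` on `I^{ℤ^d}`. -/
def localWeight {d s : ℕ} {Λ : Finset (Site d)} (a : Fin s → ℝ)
    (J : Fin s → Λ → Set unitInterval) (x : Config d) : ℝ :=
  stepFunction a J (fun q => x q)

/-- A piecewise expanding map is measurable. -/
theorem IsPiecewiseExpanding.measurable {τ : unitInterval → unitInterval}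
    (hτ : IsPiecewiseExpanding τ) : Measurable τ := by
  obtain ⟨α, -, M, ξ, hmono, h0, h1, hf⟩ := hτ
  choose f hC _h1 _h2 _h3 heq using hf
  let D : Set unitInterval := {t | ∃ j, (t : ℝ) = ξ j}
  have hD : D.Finite := by
    have : D = ⋃ j, {t : unitInterval | (t : ℝ) = ξ j} := by ext t; simp [D]
    rw [this]
    refine Set.finite_iUnion fun j => Set.Subsingleton.finite ?_
    intro s hs t ht
    exact Subtype.ext (hs.trans ht.symm)
  let U : Fin M → Set unitInterval := fun i => {t | (t : ℝ) ∈ Ioo (ξ i.castSucc) (ξ i.succ)}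
  have hU : ∀ i, MeasurableSet (U i) := fun i =>
    (isOpen_Ioo.preimage continuous_subtype_val).measurableSet
  have hcover : ∀ t : unitInterval, t ∈ D ∨ ∃ i : Fin M, t ∈ U i := by
    intro t
    by_contra! hcon
    obtain ⟨hD', hI⟩ := hcon
    have : ∀ j : Fin (M + 1), ξ j < (t : ℝ) := by
      intro j
      induction j using Fin.induction with
      | zero => exact lt_of_le_of_ne (h0 ▸ t.2.1) fun h => hD' ⟨0, h.symm⟩
      | succ i ih =>
        by_contra hle
        exact hI i ⟨ih, lt_of_le_of_ne (not_lt.1 hle) fun h => hD' ⟨_, h⟩⟩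
    have := this (Fin.last M)
    rw [h1] at this
    exact absurd t.2.2 (not_le.2 this)
  have hcomp : Measurable fun t => (τ t : ℝ) := by
    intro E hE
    have hg : ∀ i, Measurable ((U i).indicator fun t => f i (t : ℝ)) := by
      classical
      intro i
      rw [← Set.piecewise_eq_indicator]
      refine ContinuousOn.measurable_piecewise ?_ continuousOn_const (hU i)
      exact (hC i).continuousOn.comp continuous_subtype_val.continuousOn
        fun t ht => Ioo_subset_Icc_self ht
    have : (fun t => (τ t : ℝ)) ⁻¹' E = (D ∩ (fun t => (τ t : ℝ)) ⁻¹' E) ∪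
        ⋃ i, (U i ∩ ((U i).indicator fun t => f i (t : ℝ)) ⁻¹' E) := by
      ext t
      simp only [mem_preimage, mem_union, mem_inter_iff, mem_iUnion]
      constructor
      · intro h
        rcases hcover t with hd | ⟨i, hi⟩
        · exact Or.inl ⟨hd, h⟩
        · refine Or.inr ⟨i, hi, ?_⟩
          rwa [Set.indicator_of_mem hi, ← heq i t hi]
      · rintro (⟨-, h⟩ | ⟨i, hi, h⟩)
        · exact h
        · rwa [Set.indicator_of_mem hi, ← heq i t hi] at h
    rw [this]
    exact (hD.subset inter_subset_left).measurableSet.union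
      (MeasurableSet.iUnion fun i => (hU i).inter (hg i hE))
  exact hcomp.subtype_mk

/-- For admissible sizes, the coupled map is measurable. -/
theorem measurable_coupledMap {d : ℕ} {τ : unitInterval → unitInterval}
    (hτ : IsPiecewiseExpanding τ) (A : CollisionIntervals d) (pstar : Site d) {ε δ : ℝ}
    (hδ : 0 < δ) (hδε : δ ≤ ε) (hε : ε ≤ A.ε₀) : Measurable (coupledMap τ A pstar ε δ) := by
  refine measurable_pi_lambda _ fun p => hτ.measurable.comp ?_
  have hA : ∀ r v, MeasurableSet (A.interval r v) := fun r v =>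
    ((isOpen_Ioo (a := A.left r v) (b := A.left r v + r)).preimage
      continuous_subtype_val).measurableSet
  have hC : ∀ v, MeasurableSet {x | Collides A pstar ε δ x p v} := by
    intro v
    have h1 : MeasurableSet {x : Config d | x p ∈ A.interval (zoneSize pstar ε δ p (p + v)) v} :=
      measurable_pi_apply p (hA _ v)
    have h2 : MeasurableSet
        {x : Config d | x (p + v) ∈ A.interval (zoneSize pstar ε δ p (p + v)) (-v)} :=
      measurable_pi_apply (p + v) (hA _ (-v))
    exact (MeasurableSet.const (v ∈ directions d)).inter (h1.inter h2)
  intro E hE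
  have : (fun x => coupling A pstar ε δ x p) ⁻¹' E =
      (⋃ v, ({x | Collides A pstar ε δ x p v} ∩ {x | x (p + v) ∈ E})) ∪
      ((⋃ v, {x | Collides A pstar ε δ x p v})ᶜ ∩ {x | x p ∈ E}) := by
    ext x
    simp only [mem_preimage, mem_union, mem_iUnion, mem_inter_iff, mem_compl_iff, mem_ofPred_eq,
      coupling]
    split_ifs with h
    · constructor
      · intro hx
        exact Or.inl ⟨h.choose, h.choose_spec, hx⟩
      · rintro (⟨v, hv, hx⟩ | ⟨hn, -⟩)
        · rwa [Collides.unique hδ hδε hε h.choose_spec hv]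
        · exact absurd h hn
    · constructor
      · intro hx
        exact Or.inr ⟨h, hx⟩
      · rintro (⟨v, hv, -⟩ | ⟨-, hx⟩)
        · exact absurd ⟨v, hv⟩ h
        · exact hx
  rw [this]
  exact (MeasurableSet.iUnion fun v => (hC v).inter (measurable_pi_apply (p + v) hE)).union
    ((MeasurableSet.iUnion hC).compl.inter (measurable_pi_apply p hE))

theorem measurable_localWeight {d s : ℕ} {Λ : Finset (Site d)} {a : Fin s → ℝ}
    {J : Fin s → Λ → Set unitInterval} (hJ : ∀ i q, (J i q).OrdConnected) :
    Measurable (localWeight a J) := by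
  have h : Measurable (stepFunction a J) := by
    unfold stepFunction
    refine Finset.measurable_fun_sum _ fun i _ => measurable_const.indicator ?_
    exact MeasurableSet.univ_pi fun q => (hJ i q).measurableSet
  exact h.comp (measurable_pi_lambda _ fun q => measurable_pi_apply _)

/-- A complex measure has finite total variation, so bounded measurable functions are integrable
with respect to it. -/
theorem isFiniteMeasure_variation {X : Type*} [MeasurableSpace X] (μ : ComplexMeasure X) :
    IsFiniteMeasure μ.variation := by
  have hs : ∀ ν : SignedMeasure X, IsFiniteMeasure (VectorMeasure.variation ν) := by
    intro ν
    rw [← SignedMeasure.totalVariation_eq_variation, SignedMeasure.totalVariation]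
    infer_instance
  have hre := hs (ComplexMeasure.re μ)
  have him := hs (ComplexMeasure.im μ)
  refine isFiniteMeasure_of_le
    (VectorMeasure.variation (ComplexMeasure.re μ) + VectorMeasure.variation (ComplexMeasure.im μ))
    (VectorMeasure.variation_le_of_forall_enorm_le fun E _ => ?_)
  have h1 : ‖μ E‖ₑ ≤ ‖(μ E).re‖ₑ + ‖(μ E).im‖ₑ := by
    simp only [enorm_eq_nnnorm]
    exact_mod_cast Complex.norm_le_abs_re_add_abs_im (μ E)
  refine h1.trans ?_
  rw [Measure.add_apply]
  exact add_le_add (VectorMeasure.enorm_measure_le_variation (ComplexMeasure.re μ) E)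
    (VectorMeasure.enorm_measure_le_variation (ComplexMeasure.im μ) E)

/-- For `T` and `g` measurable and `g` bounded, the transfer operator takes the expected values:
`(L μ)(E) = ∫_{T⁻¹ E} g dμ`. -/
theorem transfer_apply {d : ℕ} {T : Config d → Config d} {g : Config d → ℝ}
    (hT : Measurable T) (hg : Measurable g) {K : ℝ} (hK : ∀ x, |g x| ≤ K)
    (μ : ComplexMeasure (Config d)) {E : Set (Config d)} (hE : MeasurableSet E) :
    transfer T g μ E =
      (μ.restrict (T ⁻¹' E)).integral g (ContinuousLinearMap.lsmul ℝ ℝ) := by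
  have := isFiniteMeasure_variation μ
  have hint : μ.Integrable g :=
    Integrable.of_bound hg.aestronglyMeasurable K (Filter.Eventually.of_forall hK)
  rw [transfer, VectorMeasure.map_apply _ hT hE, VectorMeasure.withDensity_apply hint]

/-- The defining relation of the transfer operator: `∫ φ d(L μ) = ∫ (φ ∘ T) g dμ`. -/
theorem pair_transfer {d : ℕ} {T : Config d → Config d} {g : Config d → ℝ}
    (hT : Measurable T) (hg : Measurable g) {K : ℝ} (hK : ∀ x, |g x| ≤ K)
    (μ : ComplexMeasure (Config d)) {φ : Config d → ℂ} (hφ : Measurable φ) {K' : ℝ}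
    (hK' : ∀ x, ‖φ x‖ ≤ K') :
    pair (transfer T g μ) φ = pair μ (fun x => φ (T x) * (g x : ℂ)) := by
  have hμ := isFiniteMeasure_variation μ
  set ν : ComplexMeasure (Config d) := μ.withDensity g (ContinuousLinearMap.lsmul ℝ ℝ) with hν_def
  have hν := isFiniteMeasure_variation ν
  have hgi : μ.Integrable g :=
    Integrable.of_bound hg.aestronglyMeasurable K (Filter.Eventually.of_forall hK)
  have hbd : ∀ ψ : Config d → ℂ, Integrable ψ μ.variation →
      Integrable (fun x => ψ x * (g x : ℂ)) μ.variation := fun ψ hψ =>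
    hψ.mul_bdd (c := K) (Complex.measurable_ofReal.comp hg).aestronglyMeasurable
      (Filter.Eventually.of_forall fun x => by simpa using hK x)
  have key : ∀ ψ : SimpleFunc (Config d) ℂ, pair ν ψ = pair μ (fun x => ψ x * (g x : ℂ)) := by
    intro ψ
    induction ψ using SimpleFunc.induction with
    | const c hs =>
      rename_i s
      classical
      have hrhs : (fun x => (SimpleFunc.piecewise s hs (SimpleFunc.const _ c)
          (SimpleFunc.const _ 0)) x * (g x : ℂ)) = s.indicator fun x => c * (g x : ℂ) := by
        ext x
        by_cases hx : x ∈ s <;> simp [hx]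
      rw [hrhs, SimpleFunc.coe_piecewise, SimpleFunc.coe_const, SimpleFunc.coe_const, pair, pair,
        Function.const_zero, Set.piecewise_eq_indicator]
      have hconst : (Function.const (Config d) c) = fun _ => c := rfl
      rw [VectorMeasure.integral_indicator hs, hconst, ← VectorMeasure.integral_indicator hs,
        VectorMeasure.integral_indicator_const c hs, VectorMeasure.integral_indicator hs,
        hν_def, VectorMeasure.withDensity_apply hgi,
        VectorMeasure.continuousLinearMap_apply_integral hgi.restrict]
      refine Eq.trans ?_ (VectorMeasure.integral_continuousLinearMap_comp (μ := μ.restrict s)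
        (C := (ContinuousLinearMap.mul ℝ ℂ c).comp Complex.ofRealCLM)
        (B := ContinuousLinearMap.mul ℝ ℂ) hgi.restrict).symm
      congr 1
      ext z
      simp
    | add hdisj h1 h2 =>
      rename_i f₁ f₂
      have hi : ∀ (f : SimpleFunc (Config d) ℂ) (m : Measure (Config d)) [IsFiniteMeasure m],
        Integrable f m := fun f m _ => f.integrable_of_isFiniteMeasure
      have e : (fun x => (f₁ + f₂) x * (g x : ℂ)) =
          fun x => f₁ x * (g x : ℂ) + f₂ x * (g x : ℂ) := by
        ext x
        simp [add_mul]
      rw [e, pair, pair, SimpleFunc.coe_add,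
        VectorMeasure.integral_add (hi f₁ _) (hi f₂ _),
        VectorMeasure.integral_fun_add (hbd _ (hi f₁ _)) (hbd _ (hi f₂ _))]
      exact congrArg₂ _ h1 h2
  have hφi : ∀ m : Measure (Config d), IsFiniteMeasure m → Integrable (fun x => φ (T x)) m :=
    fun m hm => Integrable.of_bound (hφ.comp hT).aestronglyMeasurable K'
      (Filter.Eventually.of_forall fun x => hK' (T x))
  have hψ : StronglyMeasurable fun x => φ (T x) := (hφ.comp hT).stronglyMeasurable
  have hK0 : 0 ≤ K' := (norm_nonneg _).trans (hK' (fun _ => 0))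
  have t1 := VectorMeasure.tendsto_integral_of_dominated_convergence (μ := ν)
    (B := ContinuousLinearMap.mul ℝ ℂ) (fun _ => K')
    (fun n => (SimpleFunc.stronglyMeasurable _).aestronglyMeasurable) (integrable_const _)
    (fun n => Filter.Eventually.of_forall fun x => hψ.norm_approxBounded_le hK0 n x)
    (Filter.Eventually.of_forall fun x => hψ.tendsto_approxBounded_of_norm_le (hK' _))
  have t2 : Filter.Tendsto
      (fun n => pair μ fun x => hψ.approxBounded K' n x * (g x : ℂ)) Filter.atTop
      (nhds (pair μ fun x => φ (T x) * (g x : ℂ))) := by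
    refine VectorMeasure.tendsto_integral_of_dominated_convergence (fun _ => K' * K)
      (fun n => ?_) (integrable_const _)
      (fun n => Filter.Eventually.of_forall fun x => ?_)
      (Filter.Eventually.of_forall fun x =>
        (hψ.tendsto_approxBounded_of_norm_le (hK' _)).mul_const _)
    · exact ((SimpleFunc.stronglyMeasurable _).mul
        (Complex.measurable_ofReal.comp hg).stronglyMeasurable).aestronglyMeasurable
    · rw [norm_mul]
      exact mul_le_mul (hψ.norm_approxBounded_le hK0 n x) (by simpa using hK x)
        (norm_nonneg _) hK0
  have h3 : pair (transfer T g μ) φ = pair ν fun x => φ (T x) :=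
    VectorMeasure.integral_map hT hφ.aestronglyMeasurable (hφi _ hν)
  rw [h3]
  refine tendsto_nhds_unique t1 (t2.congr fun n => ?_)
  exact (key _).symm

end CoupledLattice

end

open CoupledLattice

noncomputable section
namespace CoupledLattice

/-! The proof is a Lasota–Yorke argument along single coordinates. The coupling only exchanges
states, so the state at `p` after `n` steps is `τ^[n]` of one initial state `x q`, where `q` is the
`origin` of `p` and lies in the box of radius `n` around `p`. Hence `∂_p φ ∘ T^n`, times the weight
along the orbit, is a sum of at most `(2n+1)^d` pieces, one for each `q` (`pathFunction`).

Fix `q` and all other coordinates. Origins and weights during `n` steps depend on `x q` only through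
the rule intervals that contain `τ^[k] (x q)`, `k < n`. On a branch of `τ^[n]` this itinerary
changes at no more than `N = 2n(4d + m|Λ|)` points, where `m` is the number of terms of the step
function, whatever the sizes `ε` and `δ` are. Between two such cuts, the piece is the inverse
derivative of `τ^[n]` times the `x q`-derivative of `φ ∘ T^n`, up to a constant of modulus at most
one. Integration by parts and the uniform distortion bound give an integral of at most `(2+D)β^n`,
so integrals from the left end of a branch to any of its points are at most `R = (N+1)(2+D)β^n`.

The cells between cuts may be arbitrarily short as the sizes tend to zero, so subtracting a mean on
each cell would cost an unbounded inverse length. The means are instead taken over whole branches of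
`τ^[n]`, whose lengths do not involve `ε` and `δ`. After this subtraction the primitive along each
line is at most `2R`, which the strong norm sees, while the means are paid for by the weak norm
(`norm_pair_pathFunction_le`). Summing over `q`, the strong norm gets the coefficient `2(2n+1)^d R`,
which tends to zero. Since the weak norm does not grow, iterating one sufficiently high power yields
the result (`exists_iterate_bound`).

The pieces are discontinuous, whereas the strong norm is tested on `C¹` functions. The passage is
`norm_pair_le_of_norm_integral_line_le`: difference quotients of a merely measurable primitive are
controlled by polynomial approximation, and they converge almost everywhere because a measure of
finite strong norm does not charge coordinate hyperplanes (`variation_hyperplane_eq_zero`). -/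

/-! ### Polynomial test functions and their density. -/

/-- The function on configurations defined by a polynomial in finitely many coordinates. -/
def polyFun {d : ℕ} (P : MvPolynomial (Site d) ℂ) (x : Config d) : ℂ :=
  MvPolynomial.eval (fun p => ((x p : ℝ) : ℂ)) P

theorem continuous_polyFun {d : ℕ} (P : MvPolynomial (Site d) ℂ) : Continuous (polyFun P) := by
  unfold polyFun
  exact (MvPolynomial.continuous_eval P).comp (by fun_prop)

theorem hasDerivAt_eval_update {σ : Type*} [DecidableEq σ] (P : MvPolynomial σ ℂ) (c : σ → ℂ)
    (p : σ) (t : ℂ) :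
    HasDerivAt (fun s => MvPolynomial.eval (Function.update c p s) P)
      (MvPolynomial.eval (Function.update c p t) (MvPolynomial.pderiv p P)) t := by
  induction P using MvPolynomial.induction_on with
  | C a => simpa using hasDerivAt_const t a
  | add P Q hP hQ =>
    simp only [map_add]
    exact hP.fun_add hQ
  | mul_X P q hP =>
    have hX : HasDerivAt (fun s => Function.update c p s q) (Pi.single (M := fun _ => ℂ) p 1 q) t := by
      by_cases h : q = p
      · subst h
        simp only [Function.update_self, Pi.single_eq_same]
        exact hasDerivAt_id' t
      · simpa [h] using hasDerivAt_const t (c q)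
    simp only [map_mul, MvPolynomial.eval_X]
    refine (hP.fun_mul hX).congr_deriv ?_
    rw [Derivation.leibniz, MvPolynomial.pderiv_X]
    by_cases h : q = p
    · subst h
      simp; ring
    · simp [h]; ring

theorem slice_apply {d : ℕ} (φ : Config d → ℂ) (p : Site d) (x : Config d) (t : unitInterval) :
    slice φ p x t = φ (Function.update x p t) := by
  simp [slice]

theorem slice_update {d : ℕ} (φ : Config d → ℂ) (p : Site d) (x : Config d) (t : unitInterval) :
    slice φ p (Function.update x p t) = slice φ p x := by
  funext s
  simp [slice]

theorem slice_polyFun_hasDerivWithinAt {d : ℕ} (P : MvPolynomial (Site d) ℂ) (p : Site d)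
    (x : Config d) (t : unitInterval) :
    HasDerivWithinAt (slice (polyFun P) p x)
      (polyFun (MvPolynomial.pderiv p P) (Function.update x p t)) (Icc 0 1) (t : ℝ) := by
  have e : ∀ (Q : MvPolynomial (Site d) ℂ) (s : unitInterval),
      polyFun Q (Function.update x p s) =
        MvPolynomial.eval (Function.update (fun p => ((x p : ℝ) : ℂ)) p ((s : ℝ) : ℂ)) Q := by
    intro Q s
    unfold polyFun
    congr 1
    congr 1
    funext q
    by_cases h : q = p
    · subst h; simp
    · simp [h]
  rw [e]
  refine ((hasDerivAt_eval_update P _ p ((t : ℝ) : ℂ)).comp_ofReal.hasDerivWithinAt).congr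
    (fun s hs => ?_) ?_
  · rw [slice, projIcc_of_mem zero_le_one hs, e]
  · rw [slice_apply, e]

theorem partialDeriv_polyFun {d : ℕ} (P : MvPolynomial (Site d) ℂ) (p : Site d) :
    partialDeriv p (polyFun P) = polyFun (MvPolynomial.pderiv p P) := by
  funext x
  have := slice_polyFun_hasDerivWithinAt P p x (x p)
  rw [Function.update_eq_self] at this
  exact this.derivWithin (uniqueDiffOn_Icc zero_lt_one _ (x p).2)

theorem isLocalC1_polyFun {d : ℕ} (P : MvPolynomial (Site d) ℂ) : IsLocalC1 (polyFun P) := by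
  refine ⟨⟨P.vars, fun x y h => ?_⟩, continuous_polyFun P, fun p => ⟨fun x => ?_, ?_⟩⟩
  · unfold polyFun
    exact MvPolynomial.eval₂Hom_congr' rfl (fun i hi _ => by simp [h i hi]) rfl
  · exact (slice_polyFun_hasDerivWithinAt P p x (x p)).differentiableWithinAt
  · rw [partialDeriv_polyFun]
    exact continuous_polyFun _

/-- Primitives in one variable stay polynomial in characteristic zero. This lets an arbitrary
polynomial be treated as a derivative of another test function. -/
theorem exists_pderiv_eq {σ : Type*} (q : σ) (P : MvPolynomial σ ℂ) :
    ∃ W, MvPolynomial.pderiv q W = P := by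
  classical
  induction P using MvPolynomial.induction_on' with
  | monomial m c =>
    refine ⟨MvPolynomial.monomial (m + Finsupp.single q 1) (c / (m q + 1)), ?_⟩
    have : ((m q : ℂ) + 1) ≠ 0 := by exact_mod_cast Nat.succ_ne_zero (m q)
    rw [MvPolynomial.pderiv_monomial]
    congr 1
    · simp
    · simp [this]
  | add P Q hP hQ =>
    obtain ⟨V, hV⟩ := hP
    obtain ⟨W, hW⟩ := hQ
    exact ⟨V + W, by rw [map_add, hV, hW]⟩

/-- Continuous functions on the phase space are uniformly approximated by polynomials. -/
theorem exists_polyFun_near {d : ℕ} (f : C(Config d, ℂ)) {η : ℝ} (hη : 0 < η) :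
    ∃ P : MvPolynomial (Site d) ℂ, ∀ x, ‖polyFun P x - f x‖ < η := by
  let X : Site d → C(Config d, ℂ) := fun p =>
    ⟨fun x => ((x p : ℝ) : ℂ), by fun_prop⟩
  have hX : ∀ p, star (X p) = X p := fun p => by ext x; simp [X]
  let S : StarSubalgebra ℂ C(Config d, ℂ) :=
    { (MvPolynomial.aeval (R := ℂ) X).range with
      star_mem' := by
        rintro _ ⟨P, rfl⟩
        induction P using MvPolynomial.induction_on with
        | C a => exact ⟨MvPolynomial.C (star a), by ext; simp⟩
        | add P Q hP hQ =>
          obtain ⟨P', h1⟩ := hP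
          obtain ⟨Q', h2⟩ := hQ
          exact ⟨P' + Q', by simp_all⟩
        | mul_X P q hP =>
          obtain ⟨P', h1⟩ := hP
          exact ⟨P' * MvPolynomial.X q, by simp_all⟩ }
  have hS : S.SeparatesPoints := by
    intro x y hxy
    obtain ⟨p, hp⟩ := Function.ne_iff.1 hxy
    refine ⟨X p, ⟨X p, ⟨MvPolynomial.X p, by simp⟩, rfl⟩, ?_⟩
    simpa [X, Subtype.ext_iff] using hp
  have htop := ContinuousMap.starSubalgebra_topologicalClosure_eq_top_of_separatesPoints S hS
  have hmem : f ∈ closure (S : Set C(Config d, ℂ)) := by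
    have : f ∈ S.topologicalClosure := by rw [htop]; trivial
    exact this
  obtain ⟨g, ⟨P, hP⟩, hg⟩ := Metric.mem_closure_iff.1 hmem η hη
  refine ⟨P, fun x => ?_⟩
  have hev : polyFun P x = g x := by
    rw [← hP]
    have : ∀ Q : MvPolynomial (Site d) ℂ, polyFun Q x = (MvPolynomial.aeval X Q) x := by
      intro Q
      induction Q using MvPolynomial.induction_on with
      | C a => simp [polyFun]
      | add P Q hP hQ => simp_all [polyFun]
      | mul_X P q hP => simp_all [polyFun, X]
    exact this P
  rw [hev, ← dist_eq_norm, dist_comm]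
  exact (ContinuousMap.dist_apply_le_dist x).trans_lt hg

/-- A bounded measurable function is approximated in `L¹` by polynomials with the same bound. -/
theorem exists_polyFun_integral_sub_le {d : ℕ} (m : Measure (Config d)) [IsFiniteMeasure m]
    {F : Config d → ℂ} (hF : Measurable F) {c : ℝ} (hc : 0 < c) (hFc : ∀ x, ‖F x‖ ≤ c)
    {η : ℝ} (hη : 0 < η) :
    ∃ P : MvPolynomial (Site d) ℂ, (∀ x, ‖polyFun P x‖ ≤ c) ∧ ∫ x, ‖F x - polyFun P x‖ ∂m ≤ η := by
  have hFi : Integrable F m :=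
    Integrable.of_bound hF.aestronglyMeasurable c (Filter.Eventually.of_forall hFc)
  set M : ℝ := m.real univ with hM
  have hM0 : 0 ≤ M := measureReal_nonneg
  obtain ⟨g, hg, hgi⟩ := hFi.exists_boundedContinuous_integral_sub_le
    (show 0 < η / 4 by positivity)
  -- radial truncation
  let k : Config d → ℂ := fun x => ((c / max c ‖g x‖ : ℝ) : ℂ) * g x
  have hmax : ∀ x, 0 < max c ‖g x‖ := fun x => lt_max_of_lt_left hc
  have hkc : Continuous k := by
    have : Continuous fun x => c / max c ‖g x‖ :=
      continuous_const.div (continuous_const.max g.continuous.norm) fun x => (hmax x).ne'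
    exact (Complex.continuous_ofReal.comp this).mul g.continuous
  have hkb : ∀ x, ‖k x‖ ≤ c := by
    intro x
    rw [norm_mul, Complex.norm_real, Real.norm_of_nonneg (by have := hmax x; positivity),
      div_mul_eq_mul_div, div_le_iff₀ (hmax x)]
    exact mul_le_mul_of_nonneg_left (le_max_right _ _) hc.le
  have hkF : ∀ x, ‖F x - k x‖ ≤ 2 * ‖F x - g x‖ := by
    intro x
    -- Since `‖F x‖ ≤ c`, cutting `g` back to the ball of radius `c` moves it by no more than its
    -- distance to `F`.
    have h1 : ‖g x - k x‖ ≤ ‖F x - g x‖ := by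
      have e : g x - k x = ((1 - c / max c ‖g x‖ : ℝ) : ℂ) * g x := by
        simp only [k]; push_cast; ring
      have hle : c / max c ‖g x‖ ≤ 1 := (div_le_one (hmax x)).2 (le_max_left _ _)
      rw [e, norm_mul, Complex.norm_real, Real.norm_of_nonneg (by linarith)]
      rcases le_total c ‖g x‖ with h | h
      · rw [max_eq_right h]
        have hg0 : ‖g x‖ ≠ 0 := (hc.trans_le h).ne'
        have : (1 - c / ‖g x‖) * ‖g x‖ = ‖g x‖ - c := by field_simp
        rw [this]
        have := norm_sub_norm_le (g x) (F x)
        rw [norm_sub_rev (g x) (F x)] at this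
        linarith [hFc x]
      · rw [max_eq_left h, div_self hc.ne']
        simp
    calc ‖F x - k x‖ = ‖(F x - g x) + (g x - k x)‖ := by ring_nf
      _ ≤ ‖F x - g x‖ + ‖g x - k x‖ := norm_add_le _ _
      _ ≤ _ := by linarith
  set η' : ℝ := min c (η / (4 * (M + 1))) with hη'
  have hη'0 : 0 < η' := lt_min hc (by positivity)
  obtain ⟨Q, hQ⟩ := exists_polyFun_near ⟨k, hkc⟩ hη'0
  have hQ' : ∀ x, ‖polyFun Q x - k x‖ < η' := hQ
  -- The uniform approximant may exceed the bound `c` by `η'`; the factor `ρ` restores exactly `c`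
  -- and costs at most another `η'`.
  set ρ : ℝ := c / (c + η') with hρ
  have hρ0 : 0 < ρ := by positivity
  have hP : ∀ x, polyFun (MvPolynomial.C (ρ : ℂ) * Q) x = ρ * polyFun Q x := fun x => by
    simp [polyFun]
  have hQb : ∀ x, ‖polyFun Q x‖ ≤ c + η' := fun x => by
    have := norm_sub_norm_le (polyFun Q x) (k x)
    linarith [hkb x, hQ' x]
  have hcη : 0 < c + η' := by positivity
  have hPQ : ∀ x, ‖polyFun Q x - ρ * polyFun Q x‖ ≤ η' := by
    intro x
    have e : polyFun Q x - ρ * polyFun Q x = ((1 - ρ : ℝ) : ℂ) * polyFun Q x := by push_cast; ring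
    have h1 : 1 - ρ = η' / (c + η') := by rw [hρ]; field_simp; ring
    rw [e, norm_mul, Complex.norm_real, h1, Real.norm_of_nonneg (by positivity)]
    calc _ ≤ η' / (c + η') * (c + η') := by gcongr; exact hQb x
      _ = η' := by field_simp
  refine ⟨MvPolynomial.C (ρ : ℂ) * Q, fun x => ?_, ?_⟩
  · rw [hP, norm_mul, Complex.norm_real, Real.norm_of_nonneg hρ0.le]
    calc ρ * ‖polyFun Q x‖ ≤ ρ * (c + η') := by gcongr; exact hQb x
      _ = c := by rw [hρ]; field_simp
  · have hpt : ∀ x, ‖F x - polyFun (MvPolynomial.C (ρ : ℂ) * Q) x‖ ≤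
        2 * ‖F x - g x‖ + 2 * η' := by
      intro x
      rw [hP]
      calc ‖F x - ρ * polyFun Q x‖
          = ‖(F x - k x) - (polyFun Q x - k x) + (polyFun Q x - ρ * polyFun Q x)‖ := by
            congr 1; ring
        _ ≤ ‖F x - k x‖ + ‖polyFun Q x - k x‖ + ‖polyFun Q x - ρ * polyFun Q x‖ :=
            (norm_add_le _ _).trans (by gcongr; exact norm_sub_le _ _)
        _ ≤ _ := by linarith [hkF x, hPQ x, hQ' x]
    have hi : Integrable (fun x => ‖F x - g x‖) m := (hFi.sub hgi).norm
    calc _ ≤ ∫ x, (2 * ‖F x - g x‖ + 2 * η') ∂m := by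
          refine integral_mono_of_nonneg (Filter.Eventually.of_forall fun x => norm_nonneg _)
            ((hi.const_mul 2).add (integrable_const _)) (Filter.Eventually.of_forall hpt)
      _ = 2 * ∫ x, ‖F x - g x‖ ∂m + M * (2 * η') := by
          rw [integral_add (hi.const_mul 2) (integrable_const _), integral_const_mul,
            integral_const, smul_eq_mul]
      _ ≤ 2 * (η / 4) + M * (2 * (η / (4 * (M + 1)))) := by
          gcongr
          exact min_le_right _ _
      _ ≤ η := by
          have : M * (2 * (η / (4 * (M + 1)))) = (η / 2) * (M / (M + 1)) := by field_simp; ring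
          rw [this]
          have h1 : M / (M + 1) ≤ 1 := (div_le_one (by positivity)).2 (by linarith)
          nlinarith

/-! ### The two norms evaluated on polynomials and on bounded measurable functions. -/

theorem integrable_of_norm_le {X : Type*} [MeasurableSpace X] (m : Measure X) [IsFiniteMeasure m]
    {F : X → ℂ} (hF : Measurable F) {c : ℝ} (hFc : ∀ x, ‖F x‖ ≤ c) : Integrable F m :=
  Integrable.of_bound hF.aestronglyMeasurable c (Filter.Eventually.of_forall hFc)

theorem norm_pair_le_integral {d : ℕ} (μ : ComplexMeasure (Config d)) (φ : Config d → ℂ) :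
    ‖pair μ φ‖ ≤ ∫ x, ‖φ x‖ ∂μ.variation := by
  refine VectorMeasure.norm_integral_le_integral_norm.trans ?_
  have h : ‖ContinuousLinearMap.mul ℝ ℂ‖ ≤ 1 := ContinuousLinearMap.opNorm_mul_le ℝ ℂ
  exact mul_le_of_le_one_left (integral_nonneg fun _ => norm_nonneg _) h

theorem pair_sub {d : ℕ} {μ : ComplexMeasure (Config d)} {φ ψ : Config d → ℂ}
    (hφ : Integrable φ μ.variation) (hψ : Integrable ψ μ.variation) :
    pair μ (fun x => φ x - ψ x) = pair μ φ - pair μ ψ :=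
  VectorMeasure.integral_fun_sub hφ hψ

theorem pair_real_smul {d : ℕ} (μ : ComplexMeasure (Config d)) (r : ℝ) (φ : Config d → ℂ) :
    pair μ (fun x => (r : ℂ) * φ x) = (r : ℂ) * pair μ φ := by
  have := VectorMeasure.integral_fun_smul (μ := μ) (B := ContinuousLinearMap.mul ℝ ℂ) r φ
  simpa [pair, Complex.real_smul] using this

theorem polyFun_C_mul {d : ℕ} (r : ℝ) (P : MvPolynomial (Site d) ℂ) (x : Config d) :
    polyFun (MvPolynomial.C (r : ℂ) * P) x = (r : ℂ) * polyFun P x := by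
  simp [polyFun]

theorem weakNorm_lt_top {d : ℕ} (μ : ComplexMeasure (Config d)) : weakNorm μ < ∞ := by
  have := isFiniteMeasure_variation μ
  refine lt_of_le_of_lt (iSup₂_le fun φ hφ => ?_)
    (ENNReal.ofReal_lt_top (r := ∫ _, (1 : ℝ) ∂μ.variation))
  rw [← ofReal_norm]
  refine ENNReal.ofReal_le_ofReal ((norm_pair_le_integral μ φ).trans ?_)
  exact integral_mono_of_nonneg (Filter.Eventually.of_forall fun _ => norm_nonneg _)
    (integrable_const _) (Filter.Eventually.of_forall hφ.2)

theorem enorm_le_iff_norm_le_toReal {z : ℂ} {w : ℝ≥0∞} (hw : w ≠ ∞) :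
    ‖z‖ₑ ≤ w ↔ ‖z‖ ≤ w.toReal := by
  rw [← ofReal_norm, ENNReal.ofReal_le_iff_le_toReal hw]

theorem inv_smul_polyFun_mem_unitTests {d : ℕ} {P : MvPolynomial (Site d) ℂ} {c : ℝ} (hc : 0 < c)
    (hP : ∀ x, ‖polyFun P x‖ ≤ c) :
    polyFun (MvPolynomial.C ((c⁻¹ : ℝ) : ℂ) * P) ∈ unitTests d := by
  refine ⟨isLocalC1_polyFun _, fun x => ?_⟩
  rw [polyFun_C_mul, norm_mul, Complex.norm_real, Real.norm_of_nonneg (inv_nonneg.2 hc.le),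
    inv_mul_le_iff₀ hc, mul_one]
  exact hP x

theorem norm_pair_polyFun_le {d : ℕ} (μ : ComplexMeasure (Config d)) {P : MvPolynomial (Site d) ℂ}
    {c : ℝ} (hc : 0 < c) (hP : ∀ x, ‖polyFun P x‖ ≤ c) :
    ‖pair μ (polyFun P)‖ ≤ c * (weakNorm μ).toReal := by
  have h1 : ‖pair μ (polyFun (MvPolynomial.C ((c⁻¹ : ℝ) : ℂ) * P))‖ ≤ (weakNorm μ).toReal := by
    rw [← enorm_le_iff_norm_le_toReal (weakNorm_lt_top μ).ne]
    exact le_iSup₂ (f := fun φ (_ : φ ∈ unitTests d) => ‖pair μ φ‖ₑ) _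
      (inv_smul_polyFun_mem_unitTests hc hP)
  have h2 : polyFun (MvPolynomial.C ((c⁻¹ : ℝ) : ℂ) * P) =
      fun x => ((c⁻¹ : ℝ) : ℂ) * polyFun P x := funext (polyFun_C_mul _ P)
  rwa [h2, pair_real_smul, norm_mul, Complex.norm_real, Real.norm_of_nonneg (inv_nonneg.2 hc.le),
    inv_mul_le_iff₀ hc] at h1

theorem norm_pair_pderiv_le {d : ℕ} {μ : ComplexMeasure (Config d)} (hμ : μ ∈ bvMeasures d)
    (q : Site d) {P : MvPolynomial (Site d) ℂ} {c : ℝ} (hc : 0 < c)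
    (hP : ∀ x, ‖polyFun P x‖ ≤ c) :
    ‖pair μ (polyFun (MvPolynomial.pderiv q P))‖ ≤ c * (strongNorm μ).toReal := by
  have h1 : ‖pair μ (partialDeriv q (polyFun (MvPolynomial.C ((c⁻¹ : ℝ) : ℂ) * P)))‖ ≤
      (strongNorm μ).toReal := by
    rw [← enorm_le_iff_norm_le_toReal (ne_of_lt hμ)]
    exact (le_iSup₂ (f := fun φ (_ : φ ∈ unitTests d) => ‖pair μ (partialDeriv q φ)‖ₑ) _
      (inv_smul_polyFun_mem_unitTests hc hP)).trans
      (le_iSup (fun p => ⨆ φ ∈ unitTests d, ‖pair μ (partialDeriv p φ)‖ₑ) q)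
  have h2 : partialDeriv q (polyFun (MvPolynomial.C ((c⁻¹ : ℝ) : ℂ) * P)) =
      fun x => ((c⁻¹ : ℝ) : ℂ) * polyFun (MvPolynomial.pderiv q P) x := by
    rw [partialDeriv_polyFun, MvPolynomial.pderiv_C_mul]
    exact funext (polyFun_C_mul _ _)
  rwa [h2, pair_real_smul, norm_mul, Complex.norm_real, Real.norm_of_nonneg (inv_nonneg.2 hc.le),
    inv_mul_le_iff₀ hc] at h1

/-- The weak norm controls the integrals of all bounded measurable functions. -/
theorem norm_pair_le_weakNorm {d : ℕ} (μ : ComplexMeasure (Config d)) {F : Config d → ℂ}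
    (hF : Measurable F) {c : ℝ} (hc : 0 ≤ c) (hFc : ∀ x, ‖F x‖ ≤ c) :
    ‖pair μ F‖ ≤ c * (weakNorm μ).toReal := by
  have := isFiniteMeasure_variation μ
  rcases hc.eq_or_lt with rfl | hc
  · have hz : F = fun _ => 0 := funext fun x => norm_le_zero_iff.1 (hFc x)
    refine (norm_pair_le_integral μ F).trans ?_
    simp [hz]
  refine le_of_forall_pos_le_add fun η hη => ?_
  obtain ⟨P, hP, hFP⟩ := exists_polyFun_integral_sub_le μ.variation hF hc hFc hη
  have hsub := pair_sub (integrable_of_norm_le μ.variation hF hFc)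
    (integrable_of_norm_le μ.variation (continuous_polyFun P).measurable hP)
  calc ‖pair μ F‖ = ‖pair μ (polyFun P) + pair μ (fun x => F x - polyFun P x)‖ := by
        rw [hsub]; congr 1; ring
    _ ≤ _ := norm_add_le _ _
    _ ≤ c * (weakNorm μ).toReal + η :=
      add_le_add (norm_pair_polyFun_le μ hc hP) ((norm_pair_le_integral _ _).trans hFP)

/-! ### Difference quotients and the strong norm. -/

/-- Replace the coordinate `x_q` by `(1 - e) x_q + e b`. -/
def shrink {d : ℕ} (q : Site d) (e b : ℝ) (x : Config d) : Config d :=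
  Function.update x q (projIcc 0 1 zero_le_one ((1 - e) * (x q : ℝ) + e * b))

theorem convexComb_mem {e b t : ℝ} (he : e ∈ Icc (0 : ℝ) 1) (hb : b ∈ Icc (0 : ℝ) 1)
    (ht : t ∈ Icc (0 : ℝ) 1) : (1 - e) * t + e * b ∈ Icc (0 : ℝ) 1 :=
  (convex_Icc (0 : ℝ) 1) ht hb (by linarith [he.2]) he.1 (by ring)

theorem continuous_shrink {d : ℕ} (q : Site d) (e b : ℝ) : Continuous (shrink q e b) := by
  unfold shrink
  exact continuous_id.update q (continuous_projIcc.comp (by fun_prop))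

/-- An affine substitution keeps polynomials polynomial; the chain rule contributes the factor `1 -
e`. Value and derivative are carried together through the induction because the product rule needs
both. -/
theorem exists_polyFun_shrink {d : ℕ} (q : Site d) {e b : ℝ} (he : e ∈ Icc (0 : ℝ) 1)
    (hb : b ∈ Icc (0 : ℝ) 1) (W : MvPolynomial (Site d) ℂ) :
    ∃ V : MvPolynomial (Site d) ℂ, (∀ x, polyFun V x = polyFun W (shrink q e b x)) ∧
      ∀ x, polyFun (MvPolynomial.pderiv q V) x =
        ((1 - e : ℝ) : ℂ) * polyFun (MvPolynomial.pderiv q W) (shrink q e b x) := by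
  have hq : ∀ x : Config d, ((shrink q e b x q : ℝ) : ℂ) = (1 - e) * ((x q : ℝ) : ℂ) + e * b := by
    intro x
    rw [shrink, Function.update_self, projIcc_of_mem zero_le_one (convexComb_mem he hb (x q).2)]
    push_cast; ring
  have hne : ∀ (x : Config d) (p : Site d), p ≠ q → shrink q e b x p = x p := fun x p hp => by
    simp [shrink, hp]
  induction W using MvPolynomial.induction_on with
  | C a => exact ⟨MvPolynomial.C a, by simp [polyFun], by simp [polyFun]⟩
  | add P Q hP hQ =>
    obtain ⟨V, hV, hV'⟩ := hP
    obtain ⟨V₁, hV₁, hV₁'⟩ := hQ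
    refine ⟨V + V₁, fun x => ?_, fun x => ?_⟩
    · simp only [polyFun, map_add] at *
      rw [hV, hV₁]
    · simp only [polyFun, map_add] at *
      rw [hV', hV₁', mul_add]
  | mul_X P p hP =>
    obtain ⟨V, hV, hV'⟩ := hP
    by_cases hp : p = q
    · subst hp
      refine ⟨V * (MvPolynomial.C (1 - e : ℂ) * MvPolynomial.X p + MvPolynomial.C (e * b : ℂ)),
        fun x => ?_, fun x => ?_⟩
      · simp only [polyFun, map_add, map_mul, MvPolynomial.eval_X, MvPolynomial.eval_C] at *
        rw [hV, hq]
      · simp only [polyFun, map_add, map_mul, MvPolynomial.eval_X, MvPolynomial.eval_C,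
          Derivation.leibniz, MvPolynomial.pderiv_X_self, MvPolynomial.pderiv_C, smul_eq_mul,
          map_one, map_zero] at *
        rw [hV, hV', hq]
        push_cast
        ring
    · refine ⟨V * MvPolynomial.X p, fun x => ?_, fun x => ?_⟩
      · simp only [polyFun, map_mul, MvPolynomial.eval_X] at *
        rw [hV, hne x p hp]
      · simp only [polyFun, map_add, map_mul, MvPolynomial.eval_X,
          Derivation.leibniz, MvPolynomial.pderiv_X_of_ne hp, smul_eq_mul, map_zero] at *
        rw [hV', hne x p hp]
        ring

/-- Let `∂_q W = P`. The two shrunk points differ by `e` in the coordinate `q`, and `W` is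
`c`-Lipschitz there, so the difference of `W` at these points is at most `c * e`. Its `q`-derivative
is `1 - e` times the corresponding difference of `P`, and the strong norm bounds the integral of
that. Shrinking towards the two ends of `[0,1]` plays the role of translations, which would leave
the cube. -/
theorem norm_pair_shrink_polyFun_le {d : ℕ} {μ : ComplexMeasure (Config d)}
    (hμ : μ ∈ bvMeasures d) (q : Site d) {P : MvPolynomial (Site d) ℂ} {c : ℝ} (hc : 0 < c)
    (hP : ∀ x, ‖polyFun P x‖ ≤ c) {e : ℝ} (he₀ : 0 < e) (he₁ : e < 1) :
    (1 - e) * ‖pair μ (fun x => polyFun P (shrink q e 1 x) - polyFun P (shrink q e 0 x))‖ ≤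
      c * e * (strongNorm μ).toReal := by
  have he : e ∈ Icc (0 : ℝ) 1 := ⟨he₀.le, he₁.le⟩
  obtain ⟨W, hW⟩ := exists_pderiv_eq q P
  obtain ⟨V₁, h1, h1'⟩ := exists_polyFun_shrink q he (right_mem_Icc.2 zero_le_one) W
  obtain ⟨V₀, h0, h0'⟩ := exists_polyFun_shrink q he (left_mem_Icc.2 zero_le_one) W
  have hb : ∀ x, ‖polyFun (V₁ - V₀) x‖ ≤ c * e := by
    intro x
    have e1 : polyFun (V₁ - V₀) x = polyFun W (shrink q e 1 x) - polyFun W (shrink q e 0 x) := by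
      rw [← h1, ← h0]; simp [polyFun]
    have m1 := convexComb_mem he (right_mem_Icc.2 zero_le_one) (x q).2
    have m0 := convexComb_mem he (left_mem_Icc.2 zero_le_one) (x q).2
    have := (convex_Icc (0 : ℝ) 1).norm_image_sub_le_of_norm_hasDerivWithin_le
      (f := slice (polyFun W) q x)
      (f' := fun t => polyFun P (Function.update x q (projIcc 0 1 zero_le_one t))) (C := c)
      (fun t ht => by
        have := slice_polyFun_hasDerivWithinAt W q x ⟨t, ht⟩
        rw [hW] at this
        simpa only [projIcc_of_mem zero_le_one ht] using this)
      (fun t _ => hP _) m0 m1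
    rw [e1]
    refine this.trans_eq ?_
    have : (1 - e) * (x q : ℝ) + e * 1 - ((1 - e) * (x q : ℝ) + e * 0) = e := by ring
    rw [this, Real.norm_of_nonneg he₀.le]
  have key := norm_pair_pderiv_le hμ q (by positivity) hb
  have e2 : polyFun (MvPolynomial.pderiv q (V₁ - V₀)) = fun x => ((1 - e : ℝ) : ℂ) *
      (polyFun P (shrink q e 1 x) - polyFun P (shrink q e 0 x)) := by
    funext x
    rw [mul_sub, ← hW, ← h1', ← h0']
    simp [polyFun]
  rwa [e2, pair_real_smul, norm_mul, Complex.norm_real,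
    Real.norm_of_nonneg (by linarith)] at key

/-- Difference quotients of a bounded measurable function are controlled by the strong norm. -/
theorem norm_pair_shrink_sub_le {d : ℕ} {μ : ComplexMeasure (Config d)}
    (hμ : μ ∈ bvMeasures d) (q : Site d) {H : Config d → ℂ} (hH : Measurable H) {c : ℝ}
    (hc : 0 < c) (hHc : ∀ x, ‖H x‖ ≤ c) {e : ℝ} (he₀ : 0 < e) (he₁ : e < 1) :
    (1 - e) * ‖pair μ (fun x => H (shrink q e 1 x) - H (shrink q e 0 x))‖ ≤
      c * e * (strongNorm μ).toReal := by
  have := isFiniteMeasure_variation μ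
  have ms : ∀ b, Measurable (shrink (d := d) q e b) := fun b => (continuous_shrink q e b).measurable
  refine le_of_forall_pos_le_add fun η hη => ?_
  -- Approximating with respect to the sum of the two push-forwards makes `P` close to `H` after
  -- composition with either shrinking.
  obtain ⟨P, hP, hHP⟩ := exists_polyFun_integral_sub_le
    (μ.variation.map (shrink q e 1) + μ.variation.map (shrink q e 0)) hH hc hHc hη
  have mP := (continuous_polyFun P).measurable
  have iH : ∀ b, Integrable (fun x => H (shrink q e b x)) μ.variation := fun b =>
    integrable_of_norm_le _ (hH.comp (ms b)) fun x => hHc _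
  have iP : ∀ b, Integrable (fun x => polyFun P (shrink q e b x)) μ.variation := fun b =>
    integrable_of_norm_le _ (mP.comp (ms b)) fun x => hP _
  have iHP : ∀ m : Measure (Config d), IsFiniteMeasure m →
      Integrable (fun x => ‖H x - polyFun P x‖) m := fun m _ =>
    ((integrable_of_norm_le m hH hHc).sub (integrable_of_norm_le m mP hP)).norm
  rw [integral_add_measure (iHP _ inferInstance) (iHP _ inferInstance),
    integral_map (ms 1).aemeasurable (iHP _ inferInstance).aestronglyMeasurable,
    integral_map (ms 0).aemeasurable (iHP _ inferInstance).aestronglyMeasurable] at hHP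
  have key := norm_pair_shrink_polyFun_le hμ q hc hP he₀ he₁
  have hdiff : ‖pair μ (fun x => H (shrink q e 1 x) - H (shrink q e 0 x)) -
      pair μ (fun x => polyFun P (shrink q e 1 x) - polyFun P (shrink q e 0 x))‖ ≤ η := by
    rw [← pair_sub (φ := fun x => H (shrink q e 1 x) - H (shrink q e 0 x))
      (ψ := fun x => polyFun P (shrink q e 1 x) - polyFun P (shrink q e 0 x))
      ((iH 1).sub (iH 0)) ((iP 1).sub (iP 0))]
    refine (norm_pair_le_integral _ _).trans (le_trans ?_ hHP)
    have iN : ∀ b, Integrable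
        (fun x => ‖H (shrink q e b x) - polyFun P (shrink q e b x)‖) μ.variation :=
      fun b => ((iH b).sub (iP b)).norm
    rw [← integral_add (iN 1) (iN 0)]
    refine integral_mono_of_nonneg (Filter.Eventually.of_forall fun _ => norm_nonneg _)
      ((iN 1).add (iN 0))
      (Filter.Eventually.of_forall fun x => ?_)
    refine le_trans (le_of_eq ?_) (norm_sub_le _ _)
    beta_reduce
    congr 1
    ring
  have h3 := norm_sub_norm_le (pair μ (fun x => H (shrink q e 1 x) - H (shrink q e 0 x)))
    (pair μ (fun x => polyFun P (shrink q e 1 x) - polyFun P (shrink q e 0 x)))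
  calc _ ≤ (1 - e) * (‖pair μ (fun x => polyFun P (shrink q e 1 x) -
          polyFun P (shrink q e 0 x))‖ + η) := by
        gcongr
        · linarith
    _ ≤ c * e * (strongNorm μ).toReal + η := by
        rw [mul_add]
        gcongr
        nlinarith

/-! ### Integration by parts along coordinate lines. -/

/-- The line through `x` in the direction of the coordinate `q`, parametrized by `ℝ` and constant
outside of `[0, 1]`. -/
def line {d : ℕ} (q : Site d) (x : Config d) (t : ℝ) : Config d :=
  Function.update x q (projIcc 0 1 zero_le_one t)

theorem line_self {d : ℕ} (q : Site d) (x : Config d) : line q x (x q) = x := by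
  simp [line]

theorem line_line {d : ℕ} (q : Site d) (x : Config d) (t : ℝ) : line q (line q x t) = line q x := by
  funext s
  simp [line]

theorem line_apply_self {d : ℕ} (q : Site d) (x : Config d) {t : ℝ} (ht : t ∈ Icc (0 : ℝ) 1) :
    (line q x t q : ℝ) = t := by
  simp [line, projIcc_of_mem zero_le_one ht]

theorem measurable_line {d : ℕ} (q : Site d) :
    Measurable fun z : Config d × ℝ => line q z.1 z.2 := by
  have : Continuous fun z : Config d × ℝ => line q z.1 z.2 :=
    continuous_fst.update q (continuous_projIcc.comp continuous_snd)
  exact this.measurable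

theorem shrink_eq_line {d : ℕ} (q : Site d) (e b : ℝ) (x : Config d) :
    shrink q e b x = line q x ((1 - e) * (x q : ℝ) + e * b) := rfl

theorem intervalIntegrable_line {d : ℕ} (q : Site d) {Ψ : Config d → ℂ} (hΨ : Measurable Ψ) {C : ℝ}
    (hC : ∀ x, ‖Ψ x‖ ≤ C) (x : Config d) (u v : ℝ) :
    IntervalIntegrable (fun s => Ψ (line q x s)) volume u v := by
  have hm : Measurable fun s => Ψ (line q x s) :=
    hΨ.comp ((measurable_line q).comp measurable_prodMk_left)
  rw [intervalIntegrable_iff]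
  exact Measure.integrableOn_of_bounded (M := C) (by simp) hm.aestronglyMeasurable
    (Filter.Eventually.of_forall fun s => hC _)

theorem measurable_integral_line {d : ℕ} (q : Site d) {Ψ : Config d → ℂ} (hΨ : Measurable Ψ)
    (a : ℝ) {b : Config d → ℝ} (hb : Measurable b) (hab : ∀ x, a ≤ b x) :
    Measurable fun x => ∫ s in a..b x, Ψ (line q x s) := by
  have hm : Measurable fun z : Config d × ℝ => {z : Config d × ℝ | a < z.2 ∧ z.2 ≤ b z.1}.indicator
      (fun z => Ψ (line q z.1 z.2)) z := by
    refine (hΨ.comp (measurable_line q)).indicator ?_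
    exact (measurableSet_lt measurable_const measurable_snd).inter
      (measurableSet_le measurable_snd (hb.comp measurable_fst))
  have := (hm.stronglyMeasurable.integral_prod_right' (ν := (volume : Measure ℝ))).measurable
  have e : (fun x => ∫ s in a..b x, Ψ (line q x s)) = fun x => ∫ s,
      {z : Config d × ℝ | a < z.2 ∧ z.2 ≤ b z.1}.indicator (fun z => Ψ (line q z.1 z.2)) (x, s) := by
    funext x
    rw [intervalIntegral.integral_of_le (hab x), ← integral_indicator measurableSet_Ioc]
    rfl
  rw [e]
  exact this

/-- Integration by parts in the direction `q`: if the integrals of `Ψ` along the lines in this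
direction are bounded by `c` then `|μ(Ψ)| ≤ c ‖μ‖`. -/
theorem norm_pair_le_of_norm_integral_line_le {d : ℕ} {μ : ComplexMeasure (Config d)}
    (hμ : μ ∈ bvMeasures d) (q : Site d) {Ψ : Config d → ℂ} (hΨ : Measurable Ψ) {C : ℝ}
    (hC : ∀ x, ‖Ψ x‖ ≤ C) {c : ℝ} (hc : 0 < c)
    (hint : ∀ x, ∀ t ∈ Icc (0 : ℝ) 1, ‖∫ s in 0..t, Ψ (line q x s)‖ ≤ c)
    (hcont : ∀ᵐ x ∂μ.variation, ContinuousAt (fun s => Ψ (line q x s)) (x q)) :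
    ‖pair μ Ψ‖ ≤ c * (strongNorm μ).toReal := by
  have := isFiniteMeasure_variation μ
  -- For this primitive, the difference between the two shrunk points divided by `e` is the average
  -- of `Ψ` over the interval from `x q - e * x q` to `x q + e * (1 - x q)`, which has length `e`
  -- and contains `x q`. So the quotients keep the bound `C` and converge to `Ψ` at points of
  -- continuity.
  let H : Config d → ℂ := fun x => ∫ s in 0..(x q : ℝ), Ψ (line q x s)
  have hH : Measurable H := measurable_integral_line q hΨ 0
    (measurable_subtype_coe.comp (measurable_pi_apply q)) fun x => (x q).2.1
  have hHc : ∀ x, ‖H x‖ ≤ c := fun x => hint x _ (x q).2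
  -- The shift by 2 keeps `e n < 1` also for `n = 0`.
  let e : ℕ → ℝ := fun n => 1 / ((n : ℝ) + 2)
  have he₀ : ∀ n, 0 < e n := fun n => by positivity
  have he₁ : ∀ n, e n < 1 := fun n => by
    rw [div_lt_one (by positivity)]
    have : (0 : ℝ) ≤ n := n.cast_nonneg
    linarith
  have he : Filter.Tendsto e Filter.atTop (nhds 0) := by
    have := (tendsto_one_div_add_atTop_nhds_zero_nat (𝕜 := ℝ)).comp (Filter.tendsto_add_atTop_nat 1)
    refine this.congr fun n => ?_
    simp only [Function.comp, e]
    push_cast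
    ring
  have m1 : ∀ n (x : Config d), (1 - e n) * (x q : ℝ) + e n * 1 ∈ Icc (0 : ℝ) 1 := fun n x =>
    convexComb_mem ⟨(he₀ n).le, (he₁ n).le⟩ (right_mem_Icc.2 zero_le_one) (x q).2
  have m0 : ∀ n (x : Config d), (1 - e n) * (x q : ℝ) + e n * 0 ∈ Icc (0 : ℝ) 1 := fun n x =>
    convexComb_mem ⟨(he₀ n).le, (he₁ n).le⟩ (left_mem_Icc.2 zero_le_one) (x q).2
  have hHs : ∀ n x, H (shrink q (e n) 1 x) - H (shrink q (e n) 0 x) =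
      (∫ s in 0..((x q : ℝ) + e n * (1 - x q)), Ψ (line q x s)) -
        ∫ s in 0..((x q : ℝ) - e n * x q), Ψ (line q x s) := by
    intro n x
    simp only [H, shrink_eq_line, line_line]
    rw [line_apply_self q x (m1 n x), line_apply_self q x (m0 n x)]
    rw [show (1 - e n) * (x q : ℝ) + e n * 1 = (x q : ℝ) + e n * (1 - x q) by ring,
      show (1 - e n) * (x q : ℝ) + e n * 0 = (x q : ℝ) - e n * x q by ring]
  let Q : ℕ → Config d → ℂ := fun n x =>
    (((e n)⁻¹ : ℝ) : ℂ) * (H (shrink q (e n) 1 x) - H (shrink q (e n) 0 x))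
  have hQm : ∀ n, Measurable (Q n) := fun n =>
    ((hH.comp (continuous_shrink q (e n) 1).measurable).sub
      (hH.comp (continuous_shrink q (e n) 0).measurable)).const_mul _
  have hQb : ∀ n x, ‖Q n x‖ ≤ C := by
    intro n x
    simp only [Q]
    rw [hHs, intervalIntegral.integral_interval_sub_left
      (intervalIntegrable_line q hΨ hC x _ _) (intervalIntegrable_line q hΨ hC x _ _),
      norm_mul, Complex.norm_real, Real.norm_of_nonneg (inv_nonneg.2 (he₀ n).le),
      inv_mul_le_iff₀ (he₀ n)]
    refine (intervalIntegral.norm_integral_le_of_norm_le_const fun s _ => hC _).trans_eq ?_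
    rw [show (x q : ℝ) + e n * (1 - x q) - ((x q : ℝ) - e n * x q) = e n by ring,
      abs_of_pos (he₀ n), mul_comm]
  have hlim : ∀ᵐ x ∂μ.variation, Filter.Tendsto (fun n => Q n x) Filter.atTop (nhds (Ψ x)) := by
    filter_upwards [hcont] with x hx
    have hd : HasDerivAt (fun t => ∫ s in 0..t, Ψ (line q x s)) (Ψ x) (x q) := by
      have := intervalIntegral.integral_hasDerivAt_right
        (intervalIntegrable_line q hΨ hC x 0 (x q))
        (StronglyMeasurable.stronglyMeasurableAtFilter
          (hΨ.comp ((measurable_line q).comp measurable_prodMk_left)).stronglyMeasurable) hx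
      rwa [line_self] at this
    have d1 : HasDerivAt (fun η : ℝ => (x q : ℝ) + η * (1 - x q)) (1 - x q : ℝ) 0 := by
      simpa using ((hasDerivAt_id (0 : ℝ)).mul_const (1 - x q : ℝ)).const_add (x q : ℝ)
    have d0 : HasDerivAt (fun η : ℝ => (x q : ℝ) - η * x q) (-(x q : ℝ)) 0 := by
      simpa using ((hasDerivAt_id (0 : ℝ)).mul_const (x q : ℝ)).const_sub (x q : ℝ)
    have hd1 := HasDerivAt.scomp_of_eq (0 : ℝ) hd d1 (by simp)
    have hd0 := HasDerivAt.scomp_of_eq (0 : ℝ) hd d0 (by simp)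
    have hdd := (hd1.sub hd0).tendsto_slope_zero_right
    have hee : Filter.Tendsto e Filter.atTop (nhdsWithin 0 (Ioi 0)) :=
      tendsto_nhdsWithin_iff.2 ⟨he, Filter.Eventually.of_forall he₀⟩
    have := hdd.comp hee
    -- The two end points move with speeds `1 - x q` and `-x q`, which differ by exactly one.
    have e2 : ((1 : ℝ) - x q) • Ψ x - (-(x q : ℝ)) • Ψ x = Ψ x := by
      rw [← sub_smul]
      simp
    rw [e2] at this
    refine this.congr fun n => ?_
    simp [Q, hHs, Function.comp]
  have hlimp : Filter.Tendsto (fun n => ‖pair μ (Q n)‖) Filter.atTop (nhds ‖pair μ Ψ‖) :=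
    (VectorMeasure.tendsto_integral_of_dominated_convergence (fun _ => C)
      (fun n => (hQm n).aestronglyMeasurable) (integrable_const _)
      (fun n => Filter.Eventually.of_forall (hQb n)) hlim).norm
  have hlim2 : Filter.Tendsto (fun n => (1 - e n) * ‖pair μ (Q n)‖) Filter.atTop
      (nhds ((1 - 0) * ‖pair μ Ψ‖)) := (tendsto_const_nhds.sub he).mul hlimp
  rw [sub_zero, one_mul] at hlim2
  refine le_of_tendsto hlim2 (Filter.Eventually.of_forall fun n => ?_)
  have key := norm_pair_shrink_sub_le hμ q hH hc hHc (he₀ n) (he₁ n)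
  simp only [Q]
  rw [pair_real_smul, norm_mul, Complex.norm_real, Real.norm_of_nonneg (inv_nonneg.2 (he₀ n).le)]
  calc _ = (e n)⁻¹ * ((1 - e n) *
        ‖pair μ (fun x => H (shrink q (e n) 1 x) - H (shrink q (e n) 0 x))‖) := by ring
    _ ≤ (e n)⁻¹ * (c * e n * (strongNorm μ).toReal) :=
        mul_le_mul_of_nonneg_left key (inv_nonneg.2 (he₀ n).le)
    _ = _ := by have := (he₀ n).ne'; field_simp

/-! ### Coordinate hyperplanes are null sets. -/

/-- A measure of finite strong norm does not charge the hyperplanes `{x_q = c}`. -/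
theorem variation_hyperplane_eq_zero {d : ℕ} {μ : ComplexMeasure (Config d)}
    (hμ : μ ∈ bvMeasures d) (q : Site d) (c : unitInterval) :
    μ.variation {x | x q = c} = 0 := by
  classical
  have := isFiniteMeasure_variation μ
  have hS : MeasurableSet {x : Config d | x q = c} :=
    measurableSet_eq_fun (measurable_pi_apply q) measurable_const
  rw [VectorMeasure.variation_apply_eq_zero hS]
  intro E hEs hE
  -- Bumps equal to one at `c` and tending to zero elsewhere. Their primitives are arctangents
  -- divided by `k + 1`, hence uniformly small, so integration by parts makes their pairings vanish
  -- in the limit.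
  let f : ℕ → ℝ → ℝ := fun k s => (1 + (((k : ℝ) + 1) * (s - c)) ^ 2)⁻¹
  have hf0 : ∀ (k : ℕ) (s : ℝ), 0 < 1 + (((k : ℝ) + 1) * (s - c)) ^ 2 := fun k s => by positivity
  have hfc : ∀ k, Continuous (f k) := fun k =>
    Continuous.inv₀ (by fun_prop) fun s => (hf0 k s).ne'
  have hf1 : ∀ k s, |f k s| ≤ 1 := fun k s => by
    rw [abs_of_pos (inv_pos.2 (hf0 k s))]
    exact inv_le_one_of_one_le₀ (by nlinarith [sq_nonneg (((k : ℝ) + 1) * (s - c))])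
  have hfd : ∀ (k : ℕ) (s : ℝ), HasDerivAt (fun s => (Real.arctan (((k : ℝ) + 1) * (s - c))) / ((k : ℝ) + 1))
      (f k s) s := by
    intro k s
    have hk : ((k : ℝ) + 1) ≠ 0 := by positivity
    have := ((((hasDerivAt_id' s).sub_const (c : ℝ)).const_mul ((k : ℝ) + 1)).arctan).div_const
      ((k : ℝ) + 1)
    refine this.congr_deriv ?_
    simp only [f]
    field_simp
  have hfi : ∀ (k : ℕ) (t : ℝ), |∫ s in 0..t, f k s| ≤ 4 / ((k : ℝ) + 1) := by
    intro k t
    have hk : 0 < ((k : ℝ) + 1) := by positivity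
    rw [intervalIntegral.integral_eq_sub_of_hasDerivAt (fun s _ => hfd k s)
      ((hfc k).intervalIntegrable _ _), ← sub_div, abs_div, abs_of_pos hk]
    gcongr
    have h1 := Real.arctan_lt_pi_div_two (((k : ℝ) + 1) * (t - c))
    have h2 := Real.neg_pi_div_two_lt_arctan (((k : ℝ) + 1) * (t - c))
    have h3 := Real.arctan_lt_pi_div_two (((k : ℝ) + 1) * (0 - c))
    have h4 := Real.neg_pi_div_two_lt_arctan (((k : ℝ) + 1) * (0 - c))
    rw [abs_le]
    constructor <;> linarith [Real.pi_le_four]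
  -- The indicator of `E` on the hyperplane, extended so as to be constant in the direction `q`;
  -- this keeps the product with the bumps continuous along lines for an arbitrary measurable `E`.
  let ψ : Config d → ℂ := fun x => E.indicator (fun _ => 1) (line q x c)
  have hline : Measurable fun x : Config d => line q x (c : ℝ) :=
    (measurable_line q).comp measurable_prodMk_right
  have hψm : Measurable ψ := (measurable_const.indicator hE).comp hline
  have hψ1 : ∀ x, ‖ψ x‖ ≤ 1 := fun x => by
    simp only [ψ, indicator]
    split_ifs <;> simp
  have hψl : ∀ x t, ψ (line q x t) = ψ x := fun x t => by simp only [ψ, line_line]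
  let Ψ : ℕ → Config d → ℂ := fun k x => ψ x * ((f k (x q : ℝ) : ℝ) : ℂ)
  have hΨm : ∀ k, Measurable (Ψ k) := fun k => hψm.mul (Complex.measurable_ofReal.comp
    ((hfc k).measurable.comp (measurable_subtype_coe.comp (measurable_pi_apply q))))
  have hΨ1 : ∀ k x, ‖Ψ k x‖ ≤ 1 := fun k x => by
    simp only [Ψ]
    rw [norm_mul, Complex.norm_real]
    exact mul_le_one₀ (hψ1 x) (norm_nonneg _) (hf1 k _)
  have hbound : ∀ k, ‖pair μ (Ψ k)‖ ≤ 4 / ((k : ℝ) + 1) * (strongNorm μ).toReal := by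
    intro k
    refine norm_pair_le_of_norm_integral_line_le hμ q (hΨm k) (hΨ1 k) (by positivity)
      (fun x t ht => ?_) (Filter.Eventually.of_forall fun x => ?_)
    · have : ∫ s in 0..t, Ψ k (line q x s) = ψ x * ((∫ s in 0..t, f k s : ℝ) : ℂ) := by
        rw [← intervalIntegral.integral_ofReal, ← intervalIntegral.integral_const_mul]
        refine intervalIntegral.integral_congr fun s hs => ?_
        rw [uIcc_of_le ht.1] at hs
        simp only [Ψ]
        rw [hψl, line_apply_self q x ⟨hs.1, hs.2.trans ht.2⟩]
      rw [this, norm_mul, Complex.norm_real]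
      exact (mul_le_of_le_one_left (norm_nonneg _) (hψ1 x)).trans (hfi k t)
    · simp only [Ψ, hψl]
      refine Continuous.continuousAt ?_
      refine continuous_const.mul (Complex.continuous_ofReal.comp ((hfc k).comp ?_))
      have : (fun s => (line q x s q : ℝ)) = fun s => (projIcc 0 1 zero_le_one s : ℝ) := by
        funext s
        simp [line]
      rw [this]
      exact continuous_subtype_val.comp continuous_projIcc
  have hlim : Filter.Tendsto (fun k => pair μ (Ψ k)) Filter.atTop
      (nhds (pair μ (E.indicator fun _ => 1))) := by
    refine VectorMeasure.tendsto_integral_of_dominated_convergence (fun _ => 1)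
      (fun n => (hΨm n).aestronglyMeasurable) (integrable_const _)
      (fun n => Filter.Eventually.of_forall (hΨ1 n)) (Filter.Eventually.of_forall fun x => ?_)
    by_cases hx : x q = c
    · have h1 : ∀ k, Ψ k x = E.indicator (fun _ => 1) x := fun k => by
        simp only [Ψ, f, ψ]
        rw [← hx, line_self]
        simp
      exact tendsto_const_nhds.congr fun k => (h1 k).symm
    · have h1 : E.indicator (fun _ => (1 : ℂ)) x = 0 :=
        indicator_of_notMem (fun h => hx (hEs h)) _
      rw [h1]
      have hne : (x q : ℝ) - c ≠ 0 := sub_ne_zero.2 fun h => hx (Subtype.ext h)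
      have h2 : Filter.Tendsto (fun k : ℕ => f k (x q)) Filter.atTop (nhds 0) := by
        refine Filter.Tendsto.inv_tendsto_atTop (Filter.tendsto_atTop_add_const_left _ _ ?_)
        have h3 : Filter.Tendsto (fun k : ℕ => ((k : ℝ) + 1) ^ 2 * ((x q : ℝ) - c) ^ 2)
            Filter.atTop Filter.atTop :=
          ((Filter.tendsto_pow_atTop two_ne_zero).comp (Filter.tendsto_atTop_add_const_right _ _
            tendsto_natCast_atTop_atTop)).atTop_mul_const (by positivity)
        exact h3.congr fun k => by ring
      have h4 := ((Complex.continuous_ofReal.tendsto 0).comp h2).const_mul (ψ x)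
      simpa using h4
  have hlim0 : Filter.Tendsto (fun k => pair μ (Ψ k)) Filter.atTop (nhds 0) := by
    refine squeeze_zero_norm hbound ?_
    have h5 := (tendsto_one_div_add_atTop_nhds_zero_nat (𝕜 := ℝ)).const_mul
      (4 * (strongNorm μ).toReal)
    rw [mul_zero] at h5
    exact h5.congr fun k => by ring
  have h0 := tendsto_nhds_unique hlim hlim0
  rw [pair, VectorMeasure.integral_indicator_const (1 : ℂ) hE] at h0
  simpa using h0

theorem ae_apply_notMem {d : ℕ} {μ : ComplexMeasure (Config d)}
    (hμ : μ ∈ bvMeasures d) (q : Site d) {B : Set ℝ} (hB : B.Finite) :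
    ∀ᵐ x ∂μ.variation, (x q : ℝ) ∉ B := by
  have : ∀ᵐ x ∂μ.variation, ∀ b ∈ B, (x q : ℝ) ≠ b := by
    rw [ae_ball_iff hB.countable]
    intro b _
    by_cases hb : b ∈ Icc (0 : ℝ) 1
    · have := variation_hyperplane_eq_zero hμ q ⟨b, hb⟩
      refine (measure_eq_zero_iff_ae_notMem.1 this).mono fun x hx h => hx (Subtype.ext h)
    · exact Filter.Eventually.of_forall fun x h => hb (h ▸ (x q).2)
  exact this.mono fun x hx h => hx _ h rfl

/-! ### Branches of the iterates and distortion. -/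

/-- The `n`-th iterate of `τ` as a function on `ℝ`, constant outside of `[0, 1]`. -/
def extIter (τ : unitInterval → unitInterval) (n : ℕ) (t : ℝ) : ℝ :=
  (τ^[n] (projIcc 0 1 zero_le_one t) : ℝ)

theorem extIter_mem (τ : unitInterval → unitInterval) (n : ℕ) (t : ℝ) :
    extIter τ n t ∈ Icc (0 : ℝ) 1 := (τ^[n] _).2

theorem projIcc_extIter (τ : unitInterval → unitInterval) (n : ℕ) (t : ℝ) :
    projIcc 0 1 zero_le_one (extIter τ n t) = τ^[n] (projIcc 0 1 zero_le_one t) := by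
  simp [extIter]

theorem extIter_succ (τ : unitInterval → unitInterval) (n : ℕ) :
    extIter τ (n + 1) = extIter τ n ∘ extIter τ 1 := by
  funext t
  rw [Function.comp_apply, extIter, extIter, projIcc_extIter, Function.iterate_one,
    Function.iterate_succ_apply]

/-- `f` is differentiable on `K` with derivative at least `β⁻¹` in absolute value, and the inverse
of the derivative has a derivative bounded by `D`. -/
def HasInvDerivBound (f : ℝ → ℝ) (β D : ℝ) (K : Set ℝ) : Prop :=
  ∃ r r' : ℝ → ℝ, ∀ t ∈ K, r t ≠ 0 ∧ HasDerivAt f (r t)⁻¹ t ∧ |r t| ≤ β ∧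
    HasDerivAt r (r' t) t ∧ |r' t| ≤ D

/-- `K` is an interval on which the `n`-th iterate of `τ` is smooth, and all earlier iterates pull
intervals back to intervals. -/
structure IsBranch (τ : unitInterval → unitInterval) (β D : ℝ) (n : ℕ) (K : Set ℝ) : Prop where
  isOpen : IsOpen K
  ordConnected : K.OrdConnected
  subset : K ⊆ Ioo 0 1
  pullback : ∀ k < n, ∀ S : Set unitInterval, S.OrdConnected →
    {t | t ∈ K ∧ τ^[k] (projIcc 0 1 zero_le_one t) ∈ S}.OrdConnected
  deriv : HasInvDerivBound (extIter τ n) (β ^ n) D K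

/-- Rolle's theorem. It is needed so that finite exceptional sets have finite preimages in a branch.
-/
theorem HasInvDerivBound.injOn {f : ℝ → ℝ} {β D : ℝ} {K : Set ℝ} (h : HasInvDerivBound f β D K)
    (hK : K.OrdConnected) : InjOn f K := by
  obtain ⟨r, r', h⟩ := h
  have key : ∀ u ∈ K, ∀ v ∈ K, u < v → f u ≠ f v := by
    intro u hu v hv huv he
    have hs : Icc u v ⊆ K := hK.out hu hv
    obtain ⟨c, hc, hc0⟩ := exists_hasDerivAt_eq_zero huv
      (fun t ht => (h t (hs ht)).2.1.continuousAt.continuousWithinAt) he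
      fun t ht => (h t (hs (Ioo_subset_Icc_self ht))).2.1
    exact inv_ne_zero (h c (hs (Ioo_subset_Icc_self hc))).1 hc0
  intro u hu v hv he
  rcases lt_trichotomy u v with h1 | h1 | h1
  · exact absurd he (key u hu v hv h1)
  · exact h1
  · exact absurd he.symm (key v hv u hu h1)

/-- By the mean value theorem: the slope is at least `β⁻¹` in modulus and the image lies in an
interval of length one. With `β ^ n` in place of `β` it bounds the lengths of branches of `τ^[n]`.
-/
theorem HasInvDerivBound.sub_le {f : ℝ → ℝ} {β D : ℝ} {K : Set ℝ} (h : HasInvDerivBound f β D K)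
    (hK : K.OrdConnected) (hf : ∀ t, f t ∈ Icc (0 : ℝ) 1) {u v : ℝ} (hu : u ∈ K) (hv : v ∈ K)
    (huv : u < v) : v - u ≤ β := by
  obtain ⟨r, r', h⟩ := h
  have hs : Icc u v ⊆ K := hK.out hu hv
  obtain ⟨c, hc, hc0⟩ := exists_hasDerivAt_eq_slope f (fun t => (r t)⁻¹) huv
    (fun t ht => (h t (hs ht)).2.1.continuousAt.continuousWithinAt)
    fun t ht => (h t (hs (Ioo_subset_Icc_self ht))).2.1
  obtain ⟨h0, -, h1, -⟩ := h c (hs (Ioo_subset_Icc_self hc))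
  have hvu : v - u ≠ 0 := (sub_pos.2 huv).ne'
  have e : v - u = r c * (f v - f u) := by
    field_simp at hc0
    linarith
  have h2 : |f v - f u| ≤ 1 := by
    have a1 := hf u
    have a2 := hf v
    rw [abs_le]
    constructor <;> linarith [a1.1, a1.2, a2.1, a2.2]
  calc v - u ≤ |v - u| := le_abs_self _
    _ = |r c| * |f v - f u| := by rw [e, abs_mul]
    _ ≤ |r c| * 1 := by gcongr
    _ ≤ β := by linarith

/-- The inverse derivative of `g ∘ f` is `(r ∘ f) * s`. When it is differentiated, the chain rule
factor `s⁻¹` cancels `s` in the first term, so the distortion of `g` enters unamplified and that of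
`f` is multiplied by the contraction `β`. -/
theorem HasInvDerivBound.comp {f g : ℝ → ℝ} {β β' D D' : ℝ} {K L : Set ℝ} (hβ : 0 ≤ β)
    (hg : HasInvDerivBound g β D K) (hf : HasInvDerivBound f β' D' L) :
    HasInvDerivBound (g ∘ f) (β * β') (D' * β + D) (L ∩ f ⁻¹' K) := by
  obtain ⟨r, r', h⟩ := hg
  obtain ⟨s, s', h'⟩ := hf
  refine ⟨fun t => r (f t) * s t, fun t => r' (f t) + r (f t) * s' t, fun t ht => ?_⟩
  obtain ⟨a1, a2, a3, a4, a5⟩ := h _ ht.2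
  obtain ⟨b1, b2, b3, b4, b5⟩ := h' _ ht.1
  refine ⟨mul_ne_zero a1 b1, ?_, ?_, ?_, ?_⟩
  · rw [mul_inv]
    exact a2.comp t b2
  · rw [abs_mul]
    exact mul_le_mul a3 b3 (abs_nonneg _) hβ
  · refine ((a4.comp t b2).fun_mul b4).congr_deriv ?_
    simp only [Function.comp]
    field_simp
  · calc |r' (f t) + r (f t) * s' t| ≤ |r' (f t)| + |r (f t)| * |s' t| := by
          rw [← abs_mul]; exact abs_add_le _ _
      _ ≤ D + β * D' := add_le_add a5 (mul_le_mul a3 b5 (abs_nonneg _) hβ)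
      _ = _ := by ring

theorem ordConnected_inter_preimage {f : ℝ → ℝ} {L S : Set ℝ}
    (hL : L.OrdConnected) (hS : S.OrdConnected) (hf : MonotoneOn f L ∨ AntitoneOn f L) :
    (L ∩ f ⁻¹' S).OrdConnected := by
  refine ⟨fun u hu v hv t ht => ?_⟩
  have htL : t ∈ L := hL.out hu.1 hv.1 ht
  refine ⟨htL, ?_⟩
  rcases hf with hf | hf
  · exact hS.out hu.2 hv.2 ⟨hf hu.1 htL ht.1, hf htL hv.1 ht.2⟩
  · exact hS.out hv.2 hu.2 ⟨hf htL hv.1 ht.2, hf hu.1 htL ht.1⟩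

/-- The new step is put in front of the `n` old ones, so its distortion is damped by `β ^ n`; summed
over `n` this is a geometric series. -/
theorem IsBranch.comp {τ : unitInterval → unitInterval} {β D D' : ℝ} {n : ℕ} {K L : Set ℝ}
    (hβ : 0 ≤ β) (hK : IsBranch τ β D n K) (hLo : IsOpen L) (hLc : L.OrdConnected)
    (hL : L ⊆ Ioo 0 1) (hm : MonotoneOn (extIter τ 1) L ∨ AntitoneOn (extIter τ 1) L)
    (hd : HasInvDerivBound (extIter τ 1) β D' L) :
    IsBranch τ β (D' * β ^ n + D) (n + 1) (L ∩ extIter τ 1 ⁻¹' K) where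
  isOpen := by
    obtain ⟨r, r', h⟩ := hd
    exact ContinuousOn.isOpen_inter_preimage
      (fun t ht => (h t ht).2.1.continuousAt.continuousWithinAt) hLo hK.isOpen
  ordConnected := ordConnected_inter_preimage hLc hK.ordConnected hm
  subset := inter_subset_left.trans hL
  pullback := by
    intro k hk S hS
    rcases k with _ | k
    · have h1 : {t : ℝ | projIcc 0 1 zero_le_one t ∈ S}.OrdConnected :=
        hS.preimage_mono (monotone_projIcc _)
      exact (ordConnected_inter_preimage hLc hK.ordConnected hm).inter h1
    · have := ordConnected_inter_preimage hLc
        (hK.pullback k (Nat.lt_of_succ_lt_succ hk) S hS) hm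
      convert this using 1
      ext t
      simp only [mem_ofPred_eq, mem_inter_iff, mem_preimage, projIcc_extIter,
        Function.iterate_succ_apply, Function.iterate_zero, id]
      tauto
  deriv := by
    rw [extIter_succ, pow_succ]
    exact hK.deriv.comp (pow_nonneg hβ n) hd

/-- The branches of `τ` itself. -/
theorem IsPiecewiseExpanding.exists_first_branches {τ : unitInterval → unitInterval}
    (hτ : IsPiecewiseExpanding τ) :
    ∃ β D : ℝ, 0 < β ∧ β < 1 ∧ 0 ≤ D ∧ ∃ (M : ℕ) (L : Fin M → Set ℝ),
      Pairwise (Function.onFun Disjoint L) ∧ (Icc (0 : ℝ) 1 \ ⋃ i, L i).Finite ∧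
      ∀ i, IsOpen (L i) ∧ (L i).OrdConnected ∧ L i ⊆ Ioo 0 1 ∧
        (MonotoneOn (extIter τ 1) (L i) ∨ AntitoneOn (extIter τ 1) (L i)) ∧
        HasInvDerivBound (extIter τ 1) β D (L i) := by
  obtain ⟨α, hα, M, ξ, hmono, h0, h1, hf⟩ := hτ
  choose f hC hm _ hd heq using hf
  have hlt : ∀ i : Fin M, ξ i.castSucc < ξ i.succ := fun i => hmono i.castSucc_lt_succ
  have hud : ∀ i : Fin M, UniqueDiffOn ℝ (Icc (ξ i.castSucc) (ξ i.succ)) := fun i =>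
    uniqueDiffOn_Icc (hlt i)
  have hg : ∀ i, ContDiffOn ℝ 1 (derivWithin (f i) (Icc (ξ i.castSucc) (ξ i.succ)))
      (Icc (ξ i.castSucc) (ξ i.succ)) := fun i => (hC i).derivWithin (hud i) (by norm_num)
  have hg' : ∀ i, ContinuousOn (derivWithin (derivWithin (f i) (Icc (ξ i.castSucc) (ξ i.succ)))
      (Icc (ξ i.castSucc) (ξ i.succ))) (Icc (ξ i.castSucc) (ξ i.succ)) := fun i =>
    (hg i).continuousOn_derivWithin (hud i) le_rfl
  have hb : ∀ i, ∃ D, ∀ t ∈ Icc (ξ i.castSucc) (ξ i.succ),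
      ‖derivWithin (derivWithin (f i) (Icc (ξ i.castSucc) (ξ i.succ)))
        (Icc (ξ i.castSucc) (ξ i.succ)) t‖ ≤ D := fun i =>
    isCompact_Icc.exists_bound_of_continuousOn (hg' i)
  choose D hD using hb
  have hD0 : ∀ i, 0 ≤ D i := fun i =>
    (norm_nonneg _).trans (hD i _ (left_mem_Icc.2 (hlt i).le))
  have hα0 : 0 < α := zero_lt_one.trans hα
  have hsub : ∀ i : Fin M, Ioo (ξ i.castSucc) (ξ i.succ) ⊆ Ioo 0 1 := fun i =>
    Ioo_subset_Ioo (h0 ▸ hmono.monotone (Fin.zero_le _)) (h1 ▸ hmono.monotone (Fin.le_last _))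
  have hext : ∀ i, ∀ t ∈ Ioo (ξ i.castSucc) (ξ i.succ), extIter τ 1 t = f i t := by
    intro i t ht
    have ht' : t ∈ Icc (0 : ℝ) 1 := Ioo_subset_Icc_self (hsub i ht)
    rw [extIter, Function.iterate_one, projIcc_of_mem zero_le_one ht']
    exact heq i ⟨t, ht'⟩ ht
  -- The derivative of `1 / f'` is `-f'' / f' ^ 2`, and `|f'| ≥ 1`, so a bound on `|f''|` serves as
  -- distortion bound; the sum dominates the bounds of all branches.
  refine ⟨α⁻¹, ∑ i, D i, inv_pos.2 hα0, inv_lt_one_of_one_lt₀ hα,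
    Finset.sum_nonneg fun i _ => hD0 i, M, fun i => Ioo (ξ i.castSucc) (ξ i.succ), ?_, ?_,
    fun i => ⟨isOpen_Ioo, ordConnected_Ioo, hsub i, ?_, ?_⟩⟩
  · have key : ∀ i j : Fin M, i < j →
        Disjoint (Ioo (ξ i.castSucc) (ξ i.succ)) (Ioo (ξ j.castSucc) (ξ j.succ)) := by
      intro i j hij
      rw [Set.disjoint_left]
      intro t hti htj
      have : ξ i.succ ≤ ξ j.castSucc := hmono.monotone (Fin.succ_le_castSucc_iff.2 hij)
      linarith [hti.2, htj.1]
    intro i j hij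
    rcases lt_or_gt_of_ne hij with h | h
    · exact key i j h
    · exact (key j i h).symm
  · refine (Set.finite_range ξ).subset ?_
    rintro t ⟨ht, htn⟩
    by_contra hcon
    simp only [mem_iUnion, not_exists] at htn
    have hne : ∀ j, ξ j ≠ t := fun j h => hcon ⟨j, h⟩
    have : ∀ j : Fin (M + 1), ξ j < t := by
      intro j
      induction j using Fin.induction with
      | zero => exact lt_of_le_of_ne (h0 ▸ ht.1) (hne 0)
      | succ i ih =>
        by_contra hle
        exact htn i ⟨ih, lt_of_le_of_ne (not_lt.1 hle) (hne _).symm⟩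
    have := this (Fin.last M)
    rw [h1] at this
    exact absurd ht.2 (not_le.2 this)
  · rcases hm i with h | h
    · exact Or.inl ((h.mono Ioo_subset_Icc_self).congr fun t ht => (hext i t ht).symm)
    · exact Or.inr ((h.mono Ioo_subset_Icc_self).congr fun t ht => (hext i t ht).symm)
  · set S := Icc (ξ i.castSucc) (ξ i.succ) with hS
    refine ⟨fun t => (derivWithin (f i) S t)⁻¹,
      fun t => -derivWithin (derivWithin (f i) S) S t / derivWithin (f i) S t ^ 2,
      fun t ht => ?_⟩
    have htS : t ∈ S := Ioo_subset_Icc_self ht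
    have hnhds : S ∈ nhds t := Icc_mem_nhds ht.1 ht.2
    have hα' := hd i t htS
    have hne : derivWithin (f i) S t ≠ 0 := abs_pos.1 (hα0.trans_le hα')
    refine ⟨inv_ne_zero hne, ?_, ?_, ?_, ?_⟩
    · rw [inv_inv]
      refine (((hC i).differentiableOn (by norm_num) t htS).hasDerivWithinAt.hasDerivAt
        hnhds).congr_of_eventuallyEq ?_
      filter_upwards [Ioo_mem_nhds ht.1 ht.2] with u hu using hext i u hu
    · rw [abs_inv]
      exact inv_anti₀ hα0 hα'
    · exact (((hg i).differentiableOn (by norm_num) t htS).hasDerivWithinAt.hasDerivAt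
        hnhds).fun_inv hne
    · rw [abs_div, abs_neg, abs_pow]
      have h2 : 1 ≤ |derivWithin (f i) S t| ^ 2 := one_le_pow₀ (hα.le.trans hα')
      refine (div_le_self (abs_nonneg _) h2).trans ((hD i t htS).trans ?_)
      exact Finset.single_le_sum (fun j _ => hD0 j) (Finset.mem_univ i)

/-- The branches of the iterates of `τ`, with a uniform distortion bound. -/
theorem IsPiecewiseExpanding.exists_branches {τ : unitInterval → unitInterval}
    (hτ : IsPiecewiseExpanding τ) :
    ∃ β D : ℝ, 0 < β ∧ β < 1 ∧ 0 ≤ D ∧ ∀ n, ∃ (ι : Type) (_ : Fintype ι) (K : ι → Set ℝ),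
      Pairwise (Function.onFun Disjoint K) ∧ (Icc (0 : ℝ) 1 \ ⋃ i, K i).Finite ∧
      ∀ i, IsBranch τ β D n (K i) := by
  obtain ⟨β, D, hβ0, hβ1, hD0, M, L, hdisj, hfin, hL⟩ := hτ.exists_first_branches
  have h1β : 0 < 1 - β := sub_pos.2 hβ1
  refine ⟨β, D / (1 - β), hβ0, hβ1, by positivity, ?_⟩
  -- The exact partial sum of the geometric series is kept for the induction; the bound `D / (1 -
  -- β)` alone would not reproduce itself.
  have key : ∀ n, ∃ (ι : Type) (_ : Fintype ι) (K : ι → Set ℝ),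
      Pairwise (Function.onFun Disjoint K) ∧ (Icc (0 : ℝ) 1 \ ⋃ i, K i).Finite ∧
      ∀ i, IsBranch τ β (D / (1 - β) * (1 - β ^ n)) n (K i) := by
    intro n
    induction n with
    | zero =>
      refine ⟨Unit, inferInstance, fun _ => Ioo 0 1, fun i j h => absurd rfl h, ?_, fun _ =>
        ⟨isOpen_Ioo, ordConnected_Ioo, subset_rfl, fun k hk => absurd hk (Nat.not_lt_zero k),
          fun _ => 1, fun _ => 0, fun t ht => ⟨one_ne_zero, ?_, by simp, hasDerivAt_const _ _,
            by simp⟩⟩⟩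
      · refine (Set.toFinite {(0 : ℝ), 1}).subset ?_
        rintro t ⟨ht, htn⟩
        by_contra hcon
        simp only [mem_insert_iff, mem_singleton_iff, not_or] at hcon
        exact htn (mem_iUnion.2 ⟨(), lt_of_le_of_ne ht.1 (Ne.symm hcon.1),
          lt_of_le_of_ne ht.2 hcon.2⟩)
      · rw [inv_one]
        refine (hasDerivAt_id' t).congr_of_eventuallyEq ?_
        filter_upwards [Ioo_mem_nhds ht.1 ht.2] with u hu
        simp [extIter, projIcc_of_mem zero_le_one (Ioo_subset_Icc_self hu)]
    | succ n ih =>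
      obtain ⟨ι, _, K, hKd, hKf, hK⟩ := ih
      refine ⟨Fin M × ι, inferInstance, fun j => L j.1 ∩ extIter τ 1 ⁻¹' K j.2, ?_, ?_, ?_⟩
      · rintro ⟨i, j⟩ ⟨i', j'⟩ hne
        by_cases h : i = i'
        · have hj : j ≠ j' := fun h' => hne (by rw [h, h'])
          exact ((hKd hj).preimage _).mono inter_subset_right inter_subset_right
        · exact (hdisj h).mono inter_subset_left inter_subset_left
      · refine (hfin.union (Set.finite_iUnion fun i : Fin M => (?_ :
          (L i ∩ extIter τ 1 ⁻¹' (Icc (0 : ℝ) 1 \ ⋃ j, K j)).Finite))).subset ?_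
        · refine Set.Finite.of_finite_image (f := extIter τ 1) (hKf.subset ?_)
            (((hL i).2.2.2.2.injOn (hL i).2.1).mono inter_subset_left)
          rintro _ ⟨t, ht, rfl⟩
          exact ht.2
        · rintro t ⟨ht, htn⟩
          by_cases h : t ∈ ⋃ i, L i
          · obtain ⟨i, hi⟩ := mem_iUnion.1 h
            refine Or.inr (mem_iUnion.2 ⟨i, hi, extIter_mem τ 1 t, fun hK' => htn ?_⟩)
            obtain ⟨j, hj⟩ := mem_iUnion.1 hK'
            exact mem_iUnion.2 ⟨(i, j), hi, hj⟩
          · exact Or.inl ⟨ht, h⟩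
      · rintro ⟨i, j⟩
        obtain ⟨a1, a2, a3, a4, a5⟩ := hL i
        have := (hK j).comp hβ0.le a1 a2 a3 a4 a5
        convert this using 1
        field_simp
        ring
  intro n
  obtain ⟨ι, hι, K, h1, h2, h3⟩ := key n
  refine ⟨ι, hι, K, h1, h2, fun i => ⟨(h3 i).isOpen, (h3 i).ordConnected, (h3 i).subset,
    (h3 i).pullback, ?_⟩⟩
  obtain ⟨r, r', h⟩ := (h3 i).deriv
  refine ⟨r, r', fun t ht => ?_⟩
  obtain ⟨b1, b2, b3, b4, b5⟩ := h t ht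
  refine ⟨b1, b2, b3, b4, b5.trans (mul_le_of_le_one_right (by positivity) ?_)⟩
  have := pow_nonneg hβ0.le n
  linarith

/-! ### Cut points of itineraries. -/

/-- The two endpoints of an interval are the only points where membership can change. -/
theorem exists_finset_card_le_two {S : Set ℝ} (hS : S.OrdConnected)
    (hb : BddBelow S) (ha : BddAbove S) :
    ∃ B : Finset ℝ, B.card ≤ 2 ∧ ∀ u v, (∀ b ∈ B, b ∉ Ioo u v) →
      ∀ t ∈ Ioo u v, ∀ t' ∈ Ioo u v, t ∈ S → t' ∈ S := by
  classical
  refine ⟨{sInf S, sSup S}, Finset.card_le_two, fun u v hB t ht t' ht' htS => ?_⟩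
  by_contra hn
  rcases lt_trichotomy t t' with h | rfl | h
  · refine hB (sSup S) (by simp) ⟨ht.1.trans_le (le_csSup ha htS), ?_⟩
    refine lt_of_le_of_lt (csSup_le ⟨t, htS⟩ fun y hy => ?_) ht'.2
    by_contra hlt
    exact hn (hS.out htS hy ⟨h.le, (not_le.1 hlt).le⟩)
  · exact hn htS
  · refine hB (sInf S) (by simp) ⟨?_, (csInf_le hb htS).trans_lt ht.2⟩
    refine lt_of_lt_of_le ht'.1 (le_csInf ⟨t, htS⟩ fun y hy => ?_)
    by_contra hlt
    exact hn (hS.out hy htS ⟨(not_le.1 hlt).le, h.le⟩)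

/-- Along a branch, the itinerary of `t` with respect to a finite family of intervals changes only
at boundedly many points. -/
theorem IsBranch.exists_cuts {τ : unitInterval → unitInterval} {β D : ℝ} {n : ℕ} {K : Set ℝ}
    (hK : IsBranch τ β D n K) {κ : Type*} [Fintype κ] {F : κ → Set unitInterval}
    (hF : ∀ j, (F j).OrdConnected) :
    ∃ B : Finset ℝ, B.card ≤ n * Fintype.card κ * 2 ∧ ∀ u v, Ioo u v ⊆ K →
      (∀ b ∈ B, b ∉ Ioo u v) → ∀ t ∈ Ioo u v, ∀ t' ∈ Ioo u v, ∀ k < n, ∀ j,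
        τ^[k] (projIcc 0 1 zero_le_one t) ∈ F j ↔ τ^[k] (projIcc 0 1 zero_le_one t') ∈ F j := by
  classical
  have h : ∀ z : Fin n × κ, ∃ B : Finset ℝ, B.card ≤ 2 ∧ ∀ u v, (∀ b ∈ B, b ∉ Ioo u v) →
      ∀ t ∈ Ioo u v, ∀ t' ∈ Ioo u v,
        t ∈ {t | t ∈ K ∧ τ^[z.1] (projIcc 0 1 zero_le_one t) ∈ F z.2} →
        t' ∈ {t | t ∈ K ∧ τ^[z.1] (projIcc 0 1 zero_le_one t) ∈ F z.2} := fun z =>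
    exists_finset_card_le_two (hK.pullback z.1 z.1.2 (F z.2) (hF z.2))
      ⟨0, fun t ht => (hK.subset ht.1).1.le⟩ ⟨1, fun t ht => (hK.subset ht.1).2.le⟩
  choose B hB hB' using h
  refine ⟨Finset.univ.biUnion B, ?_, fun u v huv hb => ?_⟩
  · refine (Finset.card_biUnion_le_card_mul _ _ 2 fun z _ => hB z).trans_eq ?_
    simp
  · have key : ∀ t ∈ Ioo u v, ∀ t' ∈ Ioo u v, ∀ k < n, ∀ j,
        τ^[k] (projIcc 0 1 zero_le_one t) ∈ F j → τ^[k] (projIcc 0 1 zero_le_one t') ∈ F j :=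
      fun t ht t' ht' k hk j hj => (hB' (⟨k, hk⟩, j) u v
        (fun b hbz => hb b (Finset.mem_biUnion.2 ⟨_, Finset.mem_univ _, hbz⟩)) t ht t' ht'
        ⟨huv ht, hj⟩).2
    exact fun t ht t' ht' k hk j => ⟨key t ht t' ht' k hk j, key t' ht' t ht k hk j⟩

/-! ### Exchange partners and the origin of a state. -/

/-- The site `p + v` if there is some `v` with the property `P`, and `p` otherwise. -/
def pick {d : ℕ} (P : Site d → Prop) (p : Site d) : Site d :=
  open Classical in if h : ∃ v, P v then p + h.choose else p

/-- The site with which `p` exchanges its state, and `p` itself if it does not collide. -/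
def partner {d : ℕ} (A : CollisionIntervals d) (pstar : Site d) (ε δ : ℝ) (x : Config d)
    (p : Site d) : Site d :=
  pick (Collides A pstar ε δ x p) p

theorem coupling_apply {d : ℕ} (A : CollisionIntervals d) (pstar : Site d) (ε δ : ℝ)
    (x : Config d) (p : Site d) : coupling A pstar ε δ x p = x (partner A pstar ε δ x p) := by
  unfold coupling partner pick
  split_ifs <;> rfl

theorem neg_mem_directions {d : ℕ} {v : Site d} (hv : v ∈ directions d) : -v ∈ directions d := by
  obtain ⟨i, rfl | rfl⟩ := hv
  · exact ⟨i, Or.inr rfl⟩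
  · exact ⟨i, Or.inl (neg_neg _)⟩

theorem Collides.symm {d : ℕ} {A : CollisionIntervals d} {pstar : Site d} {ε δ : ℝ} {x : Config d}
    {p v : Site d} (h : Collides A pstar ε δ x p v) : Collides A pstar ε δ x (p + v) (-v) := by
  obtain ⟨h1, h2, h3⟩ := h
  have hz : zoneSize pstar ε δ (p + v) p = zoneSize pstar ε δ p (p + v) := by
    unfold zoneSize
    simp only [or_comm]
  refine ⟨neg_mem_directions h1, ?_, ?_⟩
  · rwa [add_neg_cancel_right, hz]
  · rwa [add_neg_cancel_right, hz, neg_neg]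

theorem partner_eq_add {d : ℕ} {A : CollisionIntervals d} {pstar : Site d} {ε δ : ℝ}
    (hδ : 0 < δ) (hδε : δ ≤ ε) (hε : ε ≤ A.ε₀) {x : Config d} {p v : Site d}
    (h : Collides A pstar ε δ x p v) : partner A pstar ε δ x p = p + v := by
  have hex : ∃ v, Collides A pstar ε δ x p v := ⟨v, h⟩
  rw [partner, pick, dif_pos hex, Collides.unique hδ hδε hε hex.choose_spec h]

theorem partner_eq_self {d : ℕ} {A : CollisionIntervals d} {pstar : Site d} {ε δ : ℝ}
    {x : Config d} {p : Site d} (h : ¬ ∃ v, Collides A pstar ε δ x p v) :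
    partner A pstar ε δ x p = p := by
  rw [partner, pick, dif_neg h]

theorem partner_involutive {d : ℕ} {A : CollisionIntervals d} (pstar : Site d) {ε δ : ℝ}
    (hδ : 0 < δ) (hδε : δ ≤ ε) (hε : ε ≤ A.ε₀) (x : Config d) :
    Function.Involutive (partner A pstar ε δ x) := by
  intro p
  by_cases h : ∃ v, Collides A pstar ε δ x p v
  · obtain ⟨v, hv⟩ := h
    rw [partner_eq_add hδ hδε hε hv, partner_eq_add hδ hδε hε hv.symm, add_neg_cancel_right]
  · rw [partner_eq_self h, partner_eq_self h]

theorem directions_apply_mem {d : ℕ} {v : Site d} (hv : v ∈ directions d) (i : Fin d) :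
    v i ∈ Icc (-1 : ℤ) 1 := by
  obtain ⟨j, rfl | rfl⟩ := hv <;> by_cases h : i = j <;> simp [h]

theorem partner_apply_sub_mem {d : ℕ} (A : CollisionIntervals d) (pstar : Site d) (ε δ : ℝ)
    (x : Config d) (p : Site d) (i : Fin d) :
    partner A pstar ε δ x p i - p i ∈ Icc (-1 : ℤ) 1 := by
  unfold partner pick
  split_ifs with h
  · simpa using directions_apply_mem h.choose_spec.1 i
  · simp

/-- The site whose state is carried to `p` in `n` steps. -/
def origin {d : ℕ} (τ : unitInterval → unitInterval) (A : CollisionIntervals d) (pstar : Site d)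
    (ε δ : ℝ) : ℕ → Config d → Site d → Site d
  | 0, _, p => p
  | n + 1, x, p =>
    origin τ A pstar ε δ n x (partner A pstar ε δ ((coupledMap τ A pstar ε δ)^[n] x) p)

theorem iterate_coupledMap_apply {d : ℕ} (τ : unitInterval → unitInterval)
    (A : CollisionIntervals d) (pstar : Site d) (ε δ : ℝ) (n : ℕ) (x : Config d) (p : Site d) :
    (coupledMap τ A pstar ε δ)^[n] x p = τ^[n] (x (origin τ A pstar ε δ n x p)) := by
  induction n generalizing p with
  | zero => rfl
  | succ n ih =>
    rw [Function.iterate_succ_apply', coupledMap, coupling_apply, ih, origin,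
      Function.iterate_succ_apply']

/-- Each coupling permutes the sites by an involution, so no initial state is ever carried to two
sites. -/
theorem origin_injective {d : ℕ} (τ : unitInterval → unitInterval) {A : CollisionIntervals d}
    (pstar : Site d) {ε δ : ℝ} (hδ : 0 < δ) (hδε : δ ≤ ε) (hε : ε ≤ A.ε₀) (n : ℕ) (x : Config d) :
    Function.Injective (origin τ A pstar ε δ n x) := by
  induction n with
  | zero => exact Function.injective_id
  | succ n ih => exact ih.comp (partner_involutive pstar hδ hδε hε _).injective

theorem origin_mem_Icc {d : ℕ} (τ : unitInterval → unitInterval) (A : CollisionIntervals d)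
    (pstar : Site d) (ε δ : ℝ) (n : ℕ) (x : Config d) (p : Site d) :
    origin τ A pstar ε δ n x p ∈ Finset.Icc (fun i => p i - n) (fun i => p i + n) := by
  have key : ∀ i, origin τ A pstar ε δ n x p i - p i ∈ Icc (-n : ℤ) n := by
    intro i
    induction n generalizing p with
    | zero => simp [origin]
    | succ n ih =>
      have h1 := ih (partner A pstar ε δ ((coupledMap τ A pstar ε δ)^[n] x) p)
      have h2 := partner_apply_sub_mem A pstar ε δ ((coupledMap τ A pstar ε δ)^[n] x) p i
      simp only [origin, mem_Icc] at *
      push_cast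
      constructor <;> linarith [h1.1, h1.2, h2.1, h2.2]
  rw [Finset.mem_Icc]
  exact ⟨fun i => by linarith [(key i).1], fun i => by linarith [(key i).2]⟩

theorem card_Icc_sub_add {d : ℕ} (p : Site d) (n : ℕ) :
    (Finset.Icc (fun i => p i - (n : ℤ)) (fun i => p i + n)).card = (2 * n + 1) ^ d := by
  have : ∀ i : Fin d, (p i + (n : ℤ) + 1 - (p i - n)).toNat = 2 * n + 1 := fun i => by omega
  rw [Pi.card_Icc]
  simp [Int.card_Icc, this]

/-! ### Dependence of the orbit on one initial coordinate. -/

/-- The intervals which govern the collisions and the weight. -/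
def ruleIntervals {d m : ℕ} {Λ : Finset (Site d)} (A : CollisionIntervals d) (ε δ : ℝ)
    (J : Fin m → Λ → Set unitInterval) : ((Fin d × Bool) × Bool) ⊕ (Fin m × Λ) → Set unitInterval
  | Sum.inl z => A.interval (if z.2 then ε else δ)
      (if z.1.2 then Pi.single z.1.1 1 else -Pi.single z.1.1 1)
  | Sum.inr z => J z.1 z.2

theorem ordConnected_ruleIntervals {d m : ℕ} {Λ : Finset (Site d)} (A : CollisionIntervals d)
    (ε δ : ℝ) {J : Fin m → Λ → Set unitInterval} (hJ : ∀ i q, (J i q).OrdConnected) (j) :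
    (ruleIntervals A ε δ J j).OrdConnected := by
  rcases j with z | z
  · exact ⟨fun u hu v hv t ht => ⟨lt_of_lt_of_le hu.1 ht.1, lt_of_le_of_lt ht.2 hv.2⟩⟩
  · exact hJ z.1 z.2

/-- Two states lie in the same members of a family of sets. -/
def SameCell {κ : Type*} (F : κ → Set unitInterval) (u u' : unitInterval) : Prop :=
  ∀ j, u ∈ F j ↔ u' ∈ F j

theorem SameCell.mem_interval_iff {d m : ℕ} {Λ : Finset (Site d)} {A : CollisionIntervals d}
    {ε δ : ℝ} {J : Fin m → Λ → Set unitInterval} {u u' : unitInterval}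
    (h : SameCell (ruleIntervals A ε δ J) u u') {v : Site d} (hv : v ∈ directions d) {r : ℝ}
    (hr : r = ε ∨ r = δ) : u ∈ A.interval r v ↔ u' ∈ A.interval r v := by
  obtain ⟨i, rfl | rfl⟩ := hv <;> obtain rfl | rfl := hr
  · simpa [ruleIntervals] using h (Sum.inl ((i, true), true))
  · simpa [ruleIntervals] using h (Sum.inl ((i, true), false))
  · simpa [ruleIntervals] using h (Sum.inl ((i, false), true))
  · simpa [ruleIntervals] using h (Sum.inl ((i, false), false))

theorem zoneSize_eq_or {d : ℕ} (pstar : Site d) (ε δ : ℝ) (p q : Site d) :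
    zoneSize pstar ε δ p q = ε ∨ zoneSize pstar ε δ p q = δ := by
  unfold zoneSize
  split_ifs
  · exact Or.inr rfl
  · exact Or.inl rfl

theorem partner_congr {d m : ℕ} {Λ : Finset (Site d)} {A : CollisionIntervals d}
    (pstar : Site d) {ε δ : ℝ} {J : Fin m → Λ → Set unitInterval} {x y : Config d}
    (h : ∀ p, SameCell (ruleIntervals A ε δ J) (x p) (y p)) :
    partner A pstar ε δ x = partner A pstar ε δ y := by
  funext p
  have : Collides A pstar ε δ x p = Collides A pstar ε δ y p := by
    funext v
    refine propext (and_congr_right fun hv => and_congr ?_ ?_)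
    · exact (h p).mem_interval_iff hv (zoneSize_eq_or _ _ _ _ _)
    · exact (h (p + v)).mem_interval_iff (neg_mem_directions hv) (zoneSize_eq_or _ _ _ _ _)
  rw [partner, partner, this]

theorem localWeight_congr {d m : ℕ} {Λ : Finset (Site d)} {A : CollisionIntervals d}
    {ε δ : ℝ} (a : Fin m → ℝ) {J : Fin m → Λ → Set unitInterval} {x y : Config d}
    (h : ∀ p, SameCell (ruleIntervals A ε δ J) (x p) (y p)) :
    localWeight a J x = localWeight a J y := by
  classical
  unfold localWeight stepFunction
  refine Finset.sum_congr rfl fun i _ => ?_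
  have : (fun q : Λ => x q) ∈ univ.pi (J i) ↔ (fun q : Λ => y q) ∈ univ.pi (J i) := by
    simp only [mem_univ_pi]
    exact forall_congr' fun q => h q (Sum.inr (i, q))
  simp only [indicator, this]

section Tracking

variable {d m : ℕ} {τ : unitInterval → unitInterval} {A : CollisionIntervals d}
  (pstar : Site d) {ε δ : ℝ} {Λ : Finset (Site d)} {J : Fin m → Λ → Set unitInterval}
  (x : Config d) (q : Site d) {u u' : unitInterval} {n : ℕ}

/-- The state at `p` is `τ^[k]` of the state at its origin. If the origin is `q`, the hypothesis on
`u` and `u'` applies; otherwise the two states are identical. -/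
theorem sameCell_iterate_of_origin_eq {k : ℕ}
    (h : SameCell (ruleIntervals A ε δ J) (τ^[k] u) (τ^[k] u'))
    (ho : origin τ A pstar ε δ k (Function.update x q u) =
      origin τ A pstar ε δ k (Function.update x q u')) (p : Site d) :
    SameCell (ruleIntervals A ε δ J)
      ((coupledMap τ A pstar ε δ)^[k] (Function.update x q u) p)
      ((coupledMap τ A pstar ε δ)^[k] (Function.update x q u') p) := by
  rw [iterate_coupledMap_apply, iterate_coupledMap_apply, ho]
  by_cases hq : origin τ A pstar ε δ k (Function.update x q u') p = q
  · rw [hq, Function.update_self, Function.update_self]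
    exact h
  · rw [Function.update_of_ne hq, Function.update_of_ne hq]
    exact fun _ => Iff.rfl

/-- Equal origins at time `k` put every site in the same cell at time `k`; then the same collisions
take place, and the origins at time `k + 1` agree. -/
theorem origin_update_congr
    (h : ∀ k < n, SameCell (ruleIntervals A ε δ J) (τ^[k] u) (τ^[k] u')) :
    ∀ k ≤ n, origin τ A pstar ε δ k (Function.update x q u) =
      origin τ A pstar ε δ k (Function.update x q u') := by
  intro k
  induction k with
  | zero => exact fun _ => rfl
  | succ k ih =>
    intro hk
    have ho := ih (Nat.le_of_succ_le hk)
    funext p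
    rw [origin, origin, ho, partner_congr pstar (sameCell_iterate_of_origin_eq pstar x q (h k hk) ho)]

/-- Origins are injective, so `p` is the only site that feels a change of `x q`. This reduces the
estimate to a one-dimensional one in the variable `u'`. -/
theorem iterate_update_eq (hδ : 0 < δ) (hδε : δ ≤ ε) (hε : ε ≤ A.ε₀)
    (h : ∀ k < n, SameCell (ruleIntervals A ε δ J) (τ^[k] u) (τ^[k] u')) {p : Site d}
    (hp : origin τ A pstar ε δ n (Function.update x q u) p = q) :
    (coupledMap τ A pstar ε δ)^[n] (Function.update x q u') =
      Function.update ((coupledMap τ A pstar ε δ)^[n] (Function.update x q u)) p (τ^[n] u') := by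
  have ho := origin_update_congr pstar x q h n le_rfl
  funext p'
  rw [iterate_coupledMap_apply, ← ho]
  by_cases hpp : p' = p
  · subst hpp
    rw [hp, Function.update_self, Function.update_self]
  · have hne : origin τ A pstar ε δ n (Function.update x q u) p' ≠ q := fun h' =>
      hpp (origin_injective τ pstar hδ hδε hε n _ (h'.trans hp.symm))
    rw [Function.update_of_ne hpp, iterate_coupledMap_apply, Function.update_of_ne hne,
      Function.update_of_ne hne]

end Tracking

/-! ### Iterates of the weighted transfer operator. -/

/-- The product of the weights along the first `n` points of an orbit. -/
def orbitWeight {d : ℕ} (T : Config d → Config d) (g : Config d → ℝ) (n : ℕ) (x : Config d) : ℝ :=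
  ∏ k ∈ Finset.range n, g (T^[k] x)

theorem abs_orbitWeight_le_one {d : ℕ} (T : Config d → Config d) {g : Config d → ℝ}
    (hg : ∀ x, |g x| ≤ 1) (n : ℕ) (x : Config d) : |orbitWeight T g n x| ≤ 1 := by
  rw [orbitWeight, Finset.abs_prod]
  exact Finset.prod_le_one (fun _ _ => abs_nonneg _) fun _ _ => hg _

theorem measurable_orbitWeight {d : ℕ} {T : Config d → Config d} {g : Config d → ℝ}
    (hT : Measurable T) (hg : Measurable g) (n : ℕ) : Measurable (orbitWeight T g n) :=
  Finset.measurable_fun_prod _ fun k _ => hg.comp (hT.iterate k)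

theorem orbitWeight_update_congr {d m : ℕ} {τ : unitInterval → unitInterval}
    {A : CollisionIntervals d} (pstar : Site d) {ε δ : ℝ} {Λ : Finset (Site d)} (a : Fin m → ℝ)
    {J : Fin m → Λ → Set unitInterval} (x : Config d) (q : Site d) {u u' : unitInterval} {n : ℕ}
    (h : ∀ k < n, SameCell (ruleIntervals A ε δ J) (τ^[k] u) (τ^[k] u')) :
    orbitWeight (coupledMap τ A pstar ε δ) (localWeight a J) n (Function.update x q u) =
      orbitWeight (coupledMap τ A pstar ε δ) (localWeight a J) n (Function.update x q u') := by
  refine Finset.prod_congr rfl fun k hk => ?_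
  have hk' := Finset.mem_range.1 hk
  exact localWeight_congr a (sameCell_iterate_of_origin_eq pstar x q (h k hk')
    (origin_update_congr pstar x q h k hk'.le))

theorem measurableSet_partner_eq {d : ℕ} {A : CollisionIntervals d} (pstar : Site d) {ε δ : ℝ}
    (hδ : 0 < δ) (hδε : δ ≤ ε) (hε : ε ≤ A.ε₀) (p p' : Site d) :
    MeasurableSet {x | partner A pstar ε δ x p = p'} := by
  have hA : ∀ r v, MeasurableSet (A.interval r v) := fun r v =>
    ((isOpen_Ioo (a := A.left r v) (b := A.left r v + r)).preimage
      continuous_subtype_val).measurableSet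
  have hC : ∀ v, MeasurableSet {x | Collides A pstar ε δ x p v} := by
    intro v
    have h1 : MeasurableSet {x : Config d | x p ∈ A.interval (zoneSize pstar ε δ p (p + v)) v} :=
      measurable_pi_apply p (hA _ v)
    have h2 : MeasurableSet
        {x : Config d | x (p + v) ∈ A.interval (zoneSize pstar ε δ p (p + v)) (-v)} :=
      measurable_pi_apply (p + v) (hA _ (-v))
    exact (MeasurableSet.const (v ∈ directions d)).inter (h1.inter h2)
  have : {x | partner A pstar ε δ x p = p'} =
      (⋃ v, {x | Collides A pstar ε δ x p v} ∩ {_x | p + v = p'}) ∪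
      ((⋃ v, {x | Collides A pstar ε δ x p v})ᶜ ∩ {_x | p = p'}) := by
    ext x
    simp only [mem_ofPred_eq, mem_union, mem_iUnion, mem_inter_iff, mem_compl_iff]
    by_cases h : ∃ v, Collides A pstar ε δ x p v
    · obtain ⟨v, hv⟩ := h
      rw [partner_eq_add hδ hδε hε hv]
      refine ⟨fun e => Or.inl ⟨v, hv, e⟩, ?_⟩
      rintro (⟨w, hw, e⟩ | ⟨hn, -⟩)
      · rwa [Collides.unique hδ hδε hε hv hw]
      · exact absurd ⟨v, hv⟩ hn
    · rw [partner_eq_self h]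
      refine ⟨fun e => Or.inr ⟨h, e⟩, ?_⟩
      rintro (⟨w, hw, -⟩ | ⟨-, e⟩)
      · exact absurd ⟨w, hw⟩ h
      · exact e
  rw [this]
  exact (MeasurableSet.iUnion fun v => (hC v).inter (MeasurableSet.const _)).union
    ((MeasurableSet.iUnion hC).compl.inter (MeasurableSet.const _))

theorem measurableSet_origin_eq {d : ℕ} {τ : unitInterval → unitInterval}
    (hτ : IsPiecewiseExpanding τ) {A : CollisionIntervals d} (pstar : Site d) {ε δ : ℝ}
    (hδ : 0 < δ) (hδε : δ ≤ ε) (hε : ε ≤ A.ε₀) (n : ℕ) (p q : Site d) :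
    MeasurableSet {x | origin τ A pstar ε δ n x p = q} := by
  induction n generalizing p with
  | zero => exact MeasurableSet.const (p = q)
  | succ n ih =>
    have hT := (measurable_coupledMap hτ A pstar hδ hδε hε).iterate n
    have : {x | origin τ A pstar ε δ (n + 1) x p = q} =
        ⋃ p', ((coupledMap τ A pstar ε δ)^[n] ⁻¹' {y | partner A pstar ε δ y p = p'}) ∩
          {x | origin τ A pstar ε δ n x p' = q} := by
      ext x
      simp [origin]
    rw [this]
    exact MeasurableSet.iUnion fun p' =>
      (hT (measurableSet_partner_eq pstar hδ hδε hε p p')).inter (ih p')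

theorem pair_iterate_transfer {d : ℕ} {T : Config d → Config d} {g : Config d → ℝ}
    (hT : Measurable T) (hg : Measurable g) (hg1 : ∀ x, |g x| ≤ 1) (n : ℕ)
    (μ : ComplexMeasure (Config d)) {φ : Config d → ℂ} (hφ : Measurable φ) {C : ℝ}
    (hC : ∀ x, ‖φ x‖ ≤ C) :
    pair ((transfer T g)^[n] μ) φ = pair μ fun x => φ (T^[n] x) * (orbitWeight T g n x : ℂ) := by
  induction n generalizing μ with
  | zero => simp [orbitWeight]
  | succ n ih =>
    have hm : Measurable fun x => φ (T^[n] x) * (orbitWeight T g n x : ℂ) :=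
      (hφ.comp (hT.iterate n)).mul
        (Complex.measurable_ofReal.comp (measurable_orbitWeight hT hg n))
    have hb : ∀ x, ‖φ (T^[n] x) * (orbitWeight T g n x : ℂ)‖ ≤ C := fun x => by
      rw [norm_mul, Complex.norm_real]
      exact (mul_le_of_le_one_right (norm_nonneg _) (abs_orbitWeight_le_one T hg1 n x)).trans (hC _)
    rw [Function.iterate_succ_apply, ih, pair_transfer hT hg hg1 μ hm hb]
    congr 1
    funext x
    rw [orbitWeight, orbitWeight, Finset.prod_range_succ']
    push_cast
    simp only [Function.iterate_succ_apply, Function.iterate_zero, id]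
    ring

/-- The weighted transfer operator does not increase the weak norm. -/
theorem weakNorm_iterate_transfer_le {d : ℕ} {T : Config d → Config d} {g : Config d → ℝ}
    (hT : Measurable T) (hg : Measurable g) (hg1 : ∀ x, |g x| ≤ 1) (n : ℕ)
    (μ : ComplexMeasure (Config d)) : weakNorm ((transfer T g)^[n] μ) ≤ weakNorm μ := by
  refine iSup₂_le fun φ hφ => ?_
  have hφm : Measurable φ := hφ.1.2.1.measurable
  rw [enorm_le_iff_norm_le_toReal (weakNorm_lt_top μ).ne, pair_iterate_transfer hT hg hg1 n μ hφm hφ.2,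
    ← one_mul (weakNorm μ).toReal]
  refine norm_pair_le_weakNorm μ ((hφm.comp (hT.iterate n)).mul
    (Complex.measurable_ofReal.comp (measurable_orbitWeight hT hg n))) zero_le_one fun x => ?_
  rw [Pi.mul_apply, norm_mul, Function.comp_apply, Function.comp_apply, Complex.norm_real]
  exact mul_le_one₀ (hφ.2 _) (norm_nonneg _) (abs_orbitWeight_le_one T hg1 n x)

/-! ### One-dimensional integral estimates. -/

/-- Integration by parts on an interval where `G` is, up to the factor `r`, a derivative. -/
theorem norm_integral_le_of_hasDerivAt {u v : ℝ} (huv : u < v) {ψ G : ℝ → ℂ} {r r' : ℝ → ℝ}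
    {b D : ℝ} (hD : 0 ≤ D) (h : ∀ s ∈ Ioo u v, HasDerivAt ψ ((r s)⁻¹ • G s) s ∧ r s ≠ 0 ∧ |r s| ≤ b ∧
      HasDerivAt r (r' s) s ∧ |r' s| ≤ D ∧ ‖ψ s‖ ≤ 1 ∧ ContinuousAt G s)
    (hGm : Measurable G) (hGi : ∀ s t, IntervalIntegrable G volume s t) :
    ‖∫ s in u..v, G s‖ ≤ 2 * b + D * (v - u) := by
  have key : ∀ s ∈ Ioo u v, ∀ t ∈ Ioo u v, s ≤ t →
      ‖∫ y in s..t, G y‖ ≤ 2 * b + D * (v - u) := by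
    intro s hs t ht hst
    have hsub : Icc s t ⊆ Ioo u v := fun y hy => ⟨hs.1.trans_le hy.1, hy.2.trans_lt ht.2⟩
    -- In the derivative of `r • ψ - ∫ G` the term `r • ψ'` cancels `G`, and `r' • ψ` remains. The
    -- mean value inequality then needs no integrability of `r'`.
    have hder : ∀ y ∈ Icc s t, HasDerivWithinAt (fun y => r y • ψ y - ∫ z in s..y, G z)
        (r' y • ψ y) (Icc s t) y := by
      intro y hy
      obtain ⟨h1, h2, h3, h4, h5, h6, h7⟩ := h y (hsub hy)
      have hI : HasDerivAt (fun y => ∫ z in s..y, G z) (G y) y :=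
        intervalIntegral.integral_hasDerivAt_right (hGi _ _)
          (hGm.stronglyMeasurable.stronglyMeasurableAtFilter) h7
      refine (((h4.fun_smul h1).fun_sub hI).congr_deriv ?_).hasDerivWithinAt
      rw [smul_inv_smul₀ h2]
      ring
    have hmv := (convex_Icc s t).norm_image_sub_le_of_norm_hasDerivWithin_le hder
      (C := D) (fun y hy => by
        obtain ⟨h1, h2, h3, h4, h5, h6, h7⟩ := h y (hsub hy)
        rw [norm_smul, ← mul_one D]
        exact mul_le_mul h5 h6 (norm_nonneg _) hD) (left_mem_Icc.2 hst) (right_mem_Icc.2 hst)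
    rw [intervalIntegral.integral_same, sub_zero, Real.norm_of_nonneg (sub_nonneg.2 hst)] at hmv
    have hb : ∀ y ∈ Ioo u v, ‖r y • ψ y‖ ≤ b := fun y hy => by
      obtain ⟨h1, h2, h3, h4, h5, h6, h7⟩ := h y hy
      rw [norm_smul]
      exact (mul_le_of_le_one_right (norm_nonneg _) h6).trans h3
    have e : ∫ y in s..t, G y = r t • ψ t - r s • ψ s -
        (r t • ψ t - (∫ y in s..t, G y) - r s • ψ s) := by ring
    have hle : D * (t - s) ≤ D * (v - u) :=
      mul_le_mul_of_nonneg_left (by linarith [hs.1, ht.2]) hD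
    rw [e]
    refine (norm_sub_le _ _).trans ((add_le_add (norm_sub_le _ _) hmv).trans ?_)
    linarith [hb s hs, hb t ht]
  -- Nothing is assumed about `ψ` and `r` at `u` and `v`, so the bound is first proved inside and
  -- then carried to the end points by continuity of the primitive of `G`.
  have hc : ∀ y, Continuous fun t => ∫ z in y..t, G z := fun y =>
    intervalIntegral.continuous_primitive hGi y
  have hm : (u + v) / 2 ∈ Ioo u v := ⟨by linarith, by linarith⟩
  have hr : Filter.Tendsto (fun t => ∫ z in ((u + v) / 2)..t, G z) (nhdsWithin v (Iio v))
      (nhds (∫ z in ((u + v) / 2)..v, G z)) := ((hc _).tendsto v).mono_left nhdsWithin_le_nhds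
  have hl : Filter.Tendsto (fun s => ∫ z in ((u + v) / 2)..s, G z) (nhdsWithin u (Ioi u))
      (nhds (∫ z in ((u + v) / 2)..u, G z)) := ((hc _).tendsto u).mono_left nhdsWithin_le_nhds
  have hlim : Filter.Tendsto (fun z : ℝ × ℝ => ‖(∫ y in ((u + v) / 2)..z.2, G y) -
      ∫ y in ((u + v) / 2)..z.1, G y‖) (nhdsWithin u (Ioi u) ×ˢ nhdsWithin v (Iio v))
      (nhds ‖(∫ y in ((u + v) / 2)..v, G y) - ∫ y in ((u + v) / 2)..u, G y‖) :=
    ((hr.comp Filter.tendsto_snd).sub (hl.comp Filter.tendsto_fst)).norm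
  rw [intervalIntegral.integral_interval_sub_left (hGi _ _) (hGi _ _)] at hlim
  refine le_of_tendsto hlim ?_
  have e1 : ∀ᶠ s in nhdsWithin u (Ioi u), s ∈ Ioo u ((u + v) / 2) :=
    Ioo_mem_nhdsGT hm.1
  have e2 : ∀ᶠ t in nhdsWithin v (Iio v), t ∈ Ioo ((u + v) / 2) v :=
    Ioo_mem_nhdsLT hm.2
  filter_upwards [e1.prod_mk e2] with z hz
  rw [intervalIntegral.integral_interval_sub_left (hGi _ _) (hGi _ _)]
  exact key _ ⟨hz.1.1, hz.1.2.trans hm.2⟩ _ ⟨hm.1.trans hz.2.1, hz.2.2⟩ (hz.1.2.trans hz.2.1).le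

/-- If the integrals over intervals without cut points are bounded, then so are all integrals, up
to the number of cut points. -/
theorem norm_integral_le_of_cuts {G : ℝ → ℂ} (hGi : ∀ s t, IntervalIntegrable G volume s t)
    {a b κ : ℝ} (hκ : 0 ≤ κ) (B : Finset ℝ) (h : ∀ u v, a ≤ u → u < v → v ≤ b →
      (∀ c ∈ B, c ∉ Ioo u v) → ‖∫ s in u..v, G s‖ ≤ κ) {u v : ℝ} (hu : a ≤ u) (huv : u ≤ v)
    (hv : v ≤ b) : ‖∫ s in u..v, G s‖ ≤ (B.card + 1) * κ := by
  classical
  have key : ∀ (N : ℕ) (v : ℝ), u ≤ v → v ≤ b → (B.filter (· ∈ Ioo u v)).card = N →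
      ‖∫ s in u..v, G s‖ ≤ (N + 1) * κ := by
    intro N
    induction N using Nat.strong_induction_on with
    | _ N ih =>
      intro v huv hv hN
      rcases huv.eq_or_lt with rfl | huv
      · simpa using by positivity
      rcases (B.filter (· ∈ Ioo u v)).eq_empty_or_nonempty with he | hne
      · have := h u v hu huv hv fun c hc hcI => by
          have : c ∈ B.filter (· ∈ Ioo u v) := Finset.mem_filter.2 ⟨hc, hcI⟩
          rw [he] at this
          exact absurd this (Finset.notMem_empty c)
        refine this.trans (le_mul_of_one_le_left hκ ?_)
        have : (0 : ℝ) ≤ N := N.cast_nonneg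
        linarith
      -- Splitting at the largest cut leaves no cut on the right and strictly fewer on the left.
      · set c := (B.filter (· ∈ Ioo u v)).max' hne with hc
        have hcm : c ∈ B.filter (· ∈ Ioo u v) := Finset.max'_mem _ _
        have hcI : c ∈ Ioo u v := (Finset.mem_filter.1 hcm).2
        have hsub : B.filter (· ∈ Ioo u c) ⊂ B.filter (· ∈ Ioo u v) := by
          refine Finset.ssubset_iff_of_subset (fun y hy => ?_) |>.2 ⟨c, hcm, fun h' => ?_⟩
          · obtain ⟨h1, h2⟩ := Finset.mem_filter.1 hy
            exact Finset.mem_filter.2 ⟨h1, h2.1, h2.2.trans hcI.2⟩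
          · exact lt_irrefl _ (Finset.mem_filter.1 h').2.2
        have hlt := Finset.card_lt_card hsub
        rw [hN] at hlt
        have h1 := ih _ hlt c hcI.1.le (hcI.2.le.trans hv) rfl
        have h2 := h c v (hu.trans hcI.1.le) hcI.2 hv fun y hy hyI =>
          absurd (Finset.le_max' _ y (Finset.mem_filter.2 ⟨hy, hcI.1.trans hyI.1, hyI.2⟩))
            (not_le.2 hyI.1)
        rw [← intervalIntegral.integral_add_adjacent_intervals (hGi u c) (hGi c v)]
        refine (norm_add_le _ _).trans ((add_le_add h1 h2).trans ?_)
        have : (((B.filter (· ∈ Ioo u c)).card : ℝ) + 1) ≤ N := by exact_mod_cast hlt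
        nlinarith
  refine (key _ v huv hv rfl).trans ?_
  gcongr
  exact Finset.filter_subset _ _

theorem integral_indicator_Ioo {a b t : ℝ} (ha : 0 ≤ a) (ht : 0 ≤ t) (h : ℝ → ℂ) :
    ∫ s in 0..t, (Ioo a b).indicator h s = ∫ s in a..max a (min t b), h s := by
  rw [intervalIntegral.integral_of_le ht, intervalIntegral.integral_of_le (le_max_left _ _),
    setIntegral_indicator measurableSet_Ioo]
  have e : Ioc 0 t ∩ Ioc a b = Ioc a (max a (min t b)) := by
    rw [Ioc_inter_Ioc, max_eq_right ha]
    ext s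
    simp only [mem_Ioc, le_max_iff]
    constructor
    · rintro ⟨h1, h2⟩
      exact ⟨h1, Or.inr h2⟩
    · rintro ⟨h1, h2 | h2⟩
      · exact absurd h1 (not_lt.2 h2)
      · exact ⟨h1, h2⟩
  rw [← e]
  exact setIntegral_congr_set ((ae_eq_refl _).inter Ioo_ae_eq_Ioc)

/-- Subtracting the averages over the intervals of a partition yields a function with a small
primitive. -/
theorem norm_integral_sub_averages_le {ι : Type*} [Fintype ι] {a b : ι → ℝ}
    (ha : ∀ i, 0 ≤ a i) (hab : ∀ i, a i < b i)
    (hdisj : Pairwise (Function.onFun Disjoint fun i => Ioo (a i) (b i)))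
    (hfin : (Icc (0 : ℝ) 1 \ ⋃ i, Ioo (a i) (b i)).Finite) {G : ℝ → ℂ}
    (hGi : ∀ s t, IntervalIntegrable G volume s t) {R : ℝ} (hR : 0 ≤ R)
    (hG : ∀ i, ∀ t ∈ Icc (a i) (b i), ‖∫ s in (a i)..t, G s‖ ≤ R) {t : ℝ}
    (ht : t ∈ Icc (0 : ℝ) 1) :
    ‖∫ s in 0..t, (G s - ∑ i, (Ioo (a i) (b i)).indicator
      (fun _ => (((b i - a i)⁻¹ : ℝ) : ℂ) * ∫ y in (a i)..(b i), G y) s)‖ ≤ 2 * R := by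
  classical
  set m : ι → ℂ := fun i => (((b i - a i)⁻¹ : ℝ) : ℂ) * ∫ y in (a i)..(b i), G y with hm
  have hGm : ∀ i u v, IntervalIntegrable (fun s => G s - m i) volume u v := fun i u v =>
    (hGi u v).sub intervalIntegrable_const
  have hii : ∀ i, IntervalIntegrable ((Ioo (a i) (b i)).indicator fun s => G s - m i) volume 0 t := by
    intro i
    rw [intervalIntegrable_iff]
    exact ((intervalIntegrable_iff.1 (hGm i 0 t)).indicator measurableSet_Ioo)
  have e : ∫ s in 0..t, (G s - ∑ i, (Ioo (a i) (b i)).indicator (fun _ => m i) s) =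
      ∑ i, ∫ s in 0..t, (Ioo (a i) (b i)).indicator (fun s => G s - m i) s := by
    rw [← intervalIntegral.integral_finsetSum fun i _ => hii i]
    refine intervalIntegral.integral_congr_ae ?_
    have hnull : volume (Icc (0 : ℝ) 1 \ ⋃ i, Ioo (a i) (b i)) = 0 := hfin.measure_zero _
    filter_upwards [measure_eq_zero_iff_ae_notMem.1 hnull] with s hs hst
    rw [uIoc_of_le ht.1] at hst
    have hsm : s ∈ ⋃ i, Ioo (a i) (b i) := by
      by_contra hcon
      exact hs ⟨⟨hst.1.le, hst.2.trans ht.2⟩, hcon⟩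
    obtain ⟨i, hi⟩ := mem_iUnion.1 hsm
    have hj : ∀ j, j ≠ i → s ∉ Ioo (a j) (b j) := fun j hji hsj =>
      Set.disjoint_left.1 (hdisj hji) hsj hi
    rw [Finset.sum_eq_single i (fun j _ hji => indicator_of_notMem (hj j hji) _) (by simp),
      Finset.sum_eq_single i (fun j _ hji => indicator_of_notMem (hj j hji) _) (by simp),
      indicator_of_mem hi, indicator_of_mem hi]
  -- An interval entirely to the left of `t` contributes zero by the choice of the mean, and one to
  -- the right is not reached. Only the interval containing `t` counts: its partial integral and the
  -- corresponding part of its mean are each at most `R`.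
  have hterm : ∀ i, ‖∫ s in 0..t, (Ioo (a i) (b i)).indicator (fun s => G s - m i) s‖ ≤
      if t ∈ Ioo (a i) (b i) then 2 * R else 0 := by
    intro i
    rw [integral_indicator_Ioo (ha i) ht.1,
      intervalIntegral.integral_sub (hGi _ _) intervalIntegrable_const,
      intervalIntegral.integral_const]
    have hba : 0 < b i - a i := sub_pos.2 (hab i)
    split_ifs with hti
    · rw [min_eq_left hti.2.le, max_eq_right hti.1.le]
      have h1 := hG i t ⟨hti.1.le, hti.2.le⟩
      have h2 := hG i (b i) (right_mem_Icc.2 (hab i).le)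
      have h3 : ‖(t - a i) • m i‖ ≤ R := by
        rw [hm, norm_smul, norm_mul, Complex.norm_real, Real.norm_of_nonneg (by linarith [hti.1]),
          Real.norm_of_nonneg (inv_nonneg.2 hba.le), ← mul_assoc]
        refine (mul_le_of_le_one_left (norm_nonneg _) ?_).trans h2
        rw [← div_eq_mul_inv, div_le_one hba]
        linarith [hti.2]
      exact (norm_sub_le _ _).trans (by linarith)
    · rcases le_or_gt t (a i) with h | h
      · rw [max_eq_left ((min_le_left _ _).trans h)]
        simp
      · have hbt : b i ≤ t := by
          by_contra hcon
          exact hti ⟨h, not_le.1 hcon⟩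
        rw [min_eq_right hbt, max_eq_right (hab i).le]
        have : (b i - a i) • m i = ∫ y in (a i)..(b i), G y := by
          rw [hm, Complex.real_smul, ← mul_assoc, ← Complex.ofReal_mul, mul_inv_cancel₀ hba.ne']
          simp
        rw [this]
        simp
  rw [e]
  refine (norm_sum_le _ _).trans ((Finset.sum_le_sum fun i _ => hterm i).trans ?_)
  by_cases hex : ∃ i, t ∈ Ioo (a i) (b i)
  · obtain ⟨i, hi⟩ := hex
    rw [Finset.sum_eq_single i (fun j _ hji => if_neg fun hsj =>
      Set.disjoint_left.1 (hdisj hji) hsj hi) (by simp), if_pos hi]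
  · rw [Finset.sum_eq_zero fun i _ => if_neg fun h => hex ⟨i, h⟩]
    positivity

theorem IsBranch.exists_eq_Ioo {τ : unitInterval → unitInterval} {β D : ℝ} {n : ℕ} {K : Set ℝ}
    (hK : IsBranch τ β D n K) (hne : K.Nonempty) : ∃ a b, a < b ∧ 0 ≤ a ∧ b ≤ 1 ∧ K = Ioo a b := by
  have hb : BddBelow K := ⟨0, fun t ht => (hK.subset ht).1.le⟩
  have ha : BddAbove K := ⟨1, fun t ht => (hK.subset ht).2.le⟩
  have hsub : K ⊆ Ioo (sInf K) (sSup K) := by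
    intro t ht
    obtain ⟨l, u, htlu, hlu⟩ := mem_nhds_iff_exists_Ioo_subset.1 (hK.isOpen.mem_nhds ht)
    have h1 : (l + t) / 2 ∈ K := hlu ⟨by linarith [htlu.1], by linarith [htlu.1, htlu.2]⟩
    have h2 : (t + u) / 2 ∈ K := hlu ⟨by linarith [htlu.1, htlu.2], by linarith [htlu.2]⟩
    exact ⟨(csInf_le hb h1).trans_lt (by linarith [htlu.1]),
      lt_of_lt_of_le (by linarith [htlu.2]) (le_csSup ha h2)⟩
  obtain ⟨t, ht⟩ := hne
  refine ⟨sInf K, sSup K, (hsub ht).1.trans (hsub ht).2,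
    le_csInf ⟨t, ht⟩ fun s hs => (hK.subset hs).1.le,
    csSup_le ⟨t, ht⟩ fun s hs => (hK.subset hs).2.le, hsub.antisymm fun s hs => ?_⟩
  obtain ⟨l, hl, hls⟩ := exists_lt_of_csInf_lt ⟨t, ht⟩ hs.1
  obtain ⟨u, hu, hsu⟩ := exists_lt_of_lt_csSup ⟨t, ht⟩ hs.2
  exact hK.ordConnected.out hl hu ⟨hls.le, hsu.le⟩

/-! ### The contribution of one initial site. -/

section PathFunction

variable {d m : ℕ} {τ : unitInterval → unitInterval} {A : CollisionIntervals d} (pstar : Site d)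
  {ε δ : ℝ} {Λ : Finset (Site d)} (a : Fin m → ℝ) {J : Fin m → Λ → Set unitInterval}

/-- The part of `(∂_p φ) ∘ T^n`, weighted along the orbit, where the state at `p` after `n` steps
comes from the site `q`. -/
def pathFunction (τ : unitInterval → unitInterval) (A : CollisionIntervals d) (ε δ : ℝ)
    (J : Fin m → Λ → Set unitInterval) (φ : Config d → ℂ) (n : ℕ) (p q : Site d)
    (x : Config d) : ℂ :=
  open Classical in
    if origin τ A pstar ε δ n x p = q then
      partialDeriv p φ ((coupledMap τ A pstar ε δ)^[n] x) *
        (orbitWeight (coupledMap τ A pstar ε δ) (localWeight a J) n x : ℂ)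
    else 0

theorem exists_norm_partialDeriv_le {φ : Config d → ℂ} (hφ : IsLocalC1 φ) (p : Site d) :
    ∃ C, ∀ x, ‖partialDeriv p φ x‖ ≤ C := by
  obtain ⟨C, hC⟩ := isCompact_univ.exists_bound_of_continuousOn (hφ.2.2 p).2.continuousOn
  exact ⟨C, fun x => hC x (mem_univ x)⟩

theorem measurable_pathFunction (hτ : IsPiecewiseExpanding τ) (hδ : 0 < δ) (hδε : δ ≤ ε)
    (hε : ε ≤ A.ε₀) (hJ : ∀ i q, (J i q).OrdConnected) {φ : Config d → ℂ} (hφ : IsLocalC1 φ)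
    (n : ℕ) (p q : Site d) : Measurable (pathFunction pstar a τ A ε δ J φ n p q) := by
  have hT := measurable_coupledMap hτ A pstar hδ hδε hε
  refine Measurable.ite (measurableSet_origin_eq hτ pstar hδ hδε hε n p q) ?_ measurable_const
  exact ((hφ.2.2 p).2.measurable.comp (hT.iterate n)).mul (Complex.measurable_ofReal.comp
    (measurable_orbitWeight hT (measurable_localWeight hJ) n))

theorem norm_pathFunction_le (hg : ∀ x, |localWeight a J x| ≤ 1) {φ : Config d → ℂ} {p : Site d}
    {C : ℝ} (hC : ∀ x, ‖partialDeriv p φ x‖ ≤ C) (n : ℕ) (q : Site d) (x : Config d) :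
    ‖pathFunction pstar a τ A ε δ J φ n p q x‖ ≤ C := by
  unfold pathFunction
  split_ifs
  · rw [norm_mul, Complex.norm_real]
    exact (mul_le_of_le_one_right (norm_nonneg _) (abs_orbitWeight_le_one _ hg n x)).trans (hC _)
  · rw [norm_zero]
    exact (norm_nonneg _).trans (hC x)

theorem sum_pathFunction (φ : Config d → ℂ) (n : ℕ) (p : Site d) (x : Config d) :
    ∑ q ∈ Finset.Icc (fun i => p i - (n : ℤ)) (fun i => p i + n),
      pathFunction pstar a τ A ε δ J φ n p q x =
    partialDeriv p φ ((coupledMap τ A pstar ε δ)^[n] x) *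
        (orbitWeight (coupledMap τ A pstar ε δ) (localWeight a J) n x : ℂ) := by
  unfold pathFunction
  rw [Finset.sum_ite_eq, if_pos (origin_mem_Icc τ A pstar ε δ n x p)]

/-- On an interval without cut points, the path function is the derivative of the test function
along the orbit. -/
theorem pathFunction_line_eq (hδ : 0 < δ) (hδε : δ ≤ ε) (hε : ε ≤ A.ε₀) (φ : Config d → ℂ) {n : ℕ}
    (p q : Site d) (x : Config d) {u v : ℝ}
    (hcell : ∀ t ∈ Ioo u v, ∀ t' ∈ Ioo u v, ∀ k < n, SameCell (ruleIntervals A ε δ J)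
      (τ^[k] (projIcc 0 1 zero_le_one t)) (τ^[k] (projIcc 0 1 zero_le_one t'))) :
    ∃ (z : Config d) (w : ℝ), (∃ y, w = orbitWeight (coupledMap τ A pstar ε δ) (localWeight a J) n y
        ∨ w = 0) ∧ ∀ s ∈ Ioo u v,
      pathFunction pstar a τ A ε δ J φ n p q (line q x s) =
        partialDeriv p φ (line p z (extIter τ n s)) * (w : ℂ) := by
  classical
  by_cases huv : u < v
  -- The midpoint serves as reference point: its origin decides whether the function vanishes on the
  -- whole cell, and its orbit supplies `z` and `w`.
  · have hm : (u + v) / 2 ∈ Ioo u v := ⟨by linarith, by linarith⟩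
    by_cases ho : origin τ A pstar ε δ n (line q x ((u + v) / 2)) p = q
    · refine ⟨(coupledMap τ A pstar ε δ)^[n] (line q x ((u + v) / 2)), _,
        ⟨line q x ((u + v) / 2), Or.inl rfl⟩, fun s hs => ?_⟩
      have h := hcell _ hm s hs
      have ho' : origin τ A pstar ε δ n (line q x s) p = q :=
        (congrFun (origin_update_congr pstar x q h n le_rfl) p).symm.trans ho
      have h1 := iterate_update_eq pstar x q hδ hδε hε h ho
      have h2 := orbitWeight_update_congr pstar a x q h
      rw [pathFunction, if_pos ho']
      simp only [line, projIcc_extIter] at h1 h2 ⊢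
      rw [h1, h2]
    · refine ⟨x, 0, ⟨x, Or.inr rfl⟩, fun s hs => ?_⟩
      have h := hcell _ hm s hs
      have ho' : origin τ A pstar ε δ n (line q x s) p ≠ q := by
        have := congrFun (origin_update_congr pstar x q h n le_rfl) p
        simp only [line] at ho ⊢
        rwa [← this]
      rw [pathFunction, if_neg ho']
      simp
  · exact ⟨x, 0, ⟨x, Or.inr rfl⟩, fun s hs => absurd (hs.1.trans hs.2) huv⟩

/-- Partial derivatives are one-sided at the faces of the cube. Since `f` takes all its values in
`[0,1]`, the chain rule still yields a two-sided derivative. -/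
theorem hasDerivAt_comp_line {φ : Config d → ℂ} (hφ : IsLocalC1 φ) (p : Site d) (z : Config d)
    {f : ℝ → ℝ} {f' s : ℝ} (hf : ∀ t, f t ∈ Icc (0 : ℝ) 1) (hd : HasDerivAt f f' s) :
    HasDerivAt (fun t => φ (line p z (f t))) (f' • partialDeriv p φ (line p z (f s))) s := by
  have h1 := ((hφ.2.2 p).1 (line p z (f s))).hasDerivWithinAt
  have h2 : slice φ p (line p z (f s)) = slice φ p z := slice_update φ p z _
  have h3 : derivWithin (slice φ p z) (Icc 0 1) (f s) = partialDeriv p φ (line p z (f s)) := by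
    rw [partialDeriv, h2, line_apply_self p z (hf s)]
  rw [h2, line_apply_self p z (hf s), h3] at h1
  exact h1.scomp_hasDerivAt s hd hf

theorem continuous_line (p : Site d) (z : Config d) : Continuous (line p z) := by
  unfold line
  exact continuous_const.update p continuous_projIcc

theorem continuousOn_pathFunction_line (hδ : 0 < δ) (hδε : δ ≤ ε) (hε : ε ≤ A.ε₀)
    {φ : Config d → ℂ} (hφ : IsLocalC1 φ) {n : ℕ} (p q : Site d) (x : Config d) {u v β D : ℝ}
    (hd : HasInvDerivBound (extIter τ n) β D (Ioo u v))
    (hcell : ∀ t ∈ Ioo u v, ∀ t' ∈ Ioo u v, ∀ k < n, SameCell (ruleIntervals A ε δ J)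
      (τ^[k] (projIcc 0 1 zero_le_one t)) (τ^[k] (projIcc 0 1 zero_le_one t'))) :
    ∀ s ∈ Ioo u v,
      ContinuousAt (fun s => pathFunction pstar a τ A ε δ J φ n p q (line q x s)) s := by
  intro s hs
  obtain ⟨r, r', hr⟩ := hd
  obtain ⟨z, w, -, h⟩ := pathFunction_line_eq pstar a hδ hδε hε φ p q x hcell
  have hc : ContinuousAt (fun s => partialDeriv p φ (line p z (extIter τ n s)) * (w : ℂ)) s := by
    have h1 : ContinuousAt (fun s => line p z (extIter τ n s)) s :=
      (continuous_line p z).continuousAt.comp (hr s hs).2.1.continuousAt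
    exact (((hφ.2.2 p).2.continuousAt).comp h1).mul continuousAt_const
  refine hc.congr ?_
  filter_upwards [Ioo_mem_nhds hs.1 hs.2] with t ht using (h t ht).symm

theorem norm_integral_pathFunction_cell_le (hτ : IsPiecewiseExpanding τ) (hδ : 0 < δ)
    (hδε : δ ≤ ε) (hε : ε ≤ A.ε₀) (hJ : ∀ i q, (J i q).OrdConnected)
    (hg : ∀ x, |localWeight a J x| ≤ 1)
    {φ : Config d → ℂ} (hφ : φ ∈ unitTests d) {n : ℕ} (p q : Site d) (x : Config d)
    {u v β D : ℝ} (huv : u < v) (hD : 0 ≤ D)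
    (hd : HasInvDerivBound (extIter τ n) β D (Ioo u v))
    (hcell : ∀ t ∈ Ioo u v, ∀ t' ∈ Ioo u v, ∀ k < n, SameCell (ruleIntervals A ε δ J)
      (τ^[k] (projIcc 0 1 zero_le_one t)) (τ^[k] (projIcc 0 1 zero_le_one t'))) :
    ‖∫ s in u..v, pathFunction pstar a τ A ε δ J φ n p q (line q x s)‖ ≤ 2 * β + D * (v - u) := by
  have hF := measurable_pathFunction pstar a hτ hδ hδε hε hJ hφ.1 n p q
  obtain ⟨C, hC⟩ := exists_norm_partialDeriv_le hφ.1 p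
  have hcont := continuousOn_pathFunction_line pstar a hδ hδε hε hφ.1 p q x hd hcell
  obtain ⟨r, r', hr⟩ := hd
  obtain ⟨z, w, hw, h⟩ := pathFunction_line_eq pstar a hδ hδε hε φ p q x hcell
  have hw1 : |w| ≤ 1 := by
    obtain ⟨y, rfl | rfl⟩ := hw
    · exact abs_orbitWeight_le_one _ hg n y
    · simp
  refine norm_integral_le_of_hasDerivAt huv (r := r) (r' := r')
    (ψ := fun s => φ (line p z (extIter τ n s)) * (w : ℂ)) hD (fun s hs => ?_)
    (hF.comp ((measurable_line q).comp measurable_prodMk_left))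
    (intervalIntegrable_line q hF (norm_pathFunction_le pstar a hg hC n q) x)
  obtain ⟨h1, h2, h3, h4, h5⟩ := hr s hs
  refine ⟨?_, h1, h3, h4, h5, ?_, hcont s hs⟩
  · refine ((hasDerivAt_comp_line hφ.1 p z (extIter_mem τ n) h2).mul_const (w : ℂ)).congr_deriv ?_
    rw [h s hs, smul_mul_assoc]
  · rw [norm_mul, Complex.norm_real]
    exact mul_le_one₀ (hφ.2 _) (norm_nonneg _) hw1

/-- The contribution of one initial site. The constants depend on the branches of `τ^n` and on the
number of rules, but not on the sizes of the intervals. -/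
theorem norm_pair_pathFunction_le (hτ : IsPiecewiseExpanding τ) (hδ : 0 < δ)
    (hδε : δ ≤ ε) (hε : ε ≤ A.ε₀) (hJ : ∀ i q, (J i q).OrdConnected)
    (hg : ∀ x, |localWeight a J x| ≤ 1) {β D : ℝ} (hβ : 0 < β) (hD : 0 ≤ D) {n : ℕ}
    {ι : Type} [Fintype ι] {l r : ι → ℝ} (hl : ∀ i, 0 ≤ l i) (hlr : ∀ i, l i < r i)
    (hdisj : Pairwise (Function.onFun Disjoint fun i => Ioo (l i) (r i)))
    (hfin : (Icc (0 : ℝ) 1 \ ⋃ i, Ioo (l i) (r i)).Finite)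
    (hbr : ∀ i, IsBranch τ β D n (Ioo (l i) (r i)))
    {φ : Config d → ℂ} (hφ : φ ∈ unitTests d) (p q : Site d) {μ : ComplexMeasure (Config d)}
    (hμ : μ ∈ bvMeasures d) :
    ‖pair μ (pathFunction pstar a τ A ε δ J φ n p q)‖ ≤
      (((n * (4 * d + m * Λ.card) * 2 : ℕ) : ℝ) + 1) * ((2 + D) * β ^ n) *
        (2 * (strongNorm μ).toReal + (∑ i, (r i - l i)⁻¹) * (weakNorm μ).toReal) := by
  classical
  have := isFiniteMeasure_variation μ
  set F := pathFunction pstar a τ A ε δ J φ n p q with hFdef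
  have hF : Measurable F := measurable_pathFunction pstar a hτ hδ hδε hε hJ hφ.1 n p q
  obtain ⟨C, hC'⟩ := exists_norm_partialDeriv_le hφ.1 p
  have hC : ∀ x, ‖F x‖ ≤ C := norm_pathFunction_le pstar a hg hC' n q
  -- There are `4 * d` collision intervals (axis, sign, size) and one interval for each term of the
  -- weight and each site of `Λ`; each has two ends at each of `n` times.
  set N : ℕ := n * (4 * d + m * Λ.card) * 2 with hN
  set R : ℝ := ((N : ℝ) + 1) * ((2 + D) * β ^ n) with hR
  have hR0 : 0 < R := by positivity
  have hcuts := fun i => (hbr i).exists_cuts (ordConnected_ruleIntervals A ε δ hJ)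
  choose B hBcard hB using hcuts
  have hBcard' : ∀ i, (B i).card ≤ N := fun i => by
    refine (hBcard i).trans_eq ?_
    simp only [hN, Fintype.card_sum, Fintype.card_prod, Fintype.card_fin, Fintype.card_bool,
      Fintype.card_coe]
    ring
  have hGi : ∀ x s t, IntervalIntegrable (fun s => F (line q x s)) volume s t := fun x =>
    intervalIntegrable_line q hF hC x
  have hmono : ∀ i u v, Ioo u v ⊆ Ioo (l i) (r i) →
      HasInvDerivBound (extIter τ n) (β ^ n) D (Ioo u v) := fun i u v h => by
    obtain ⟨ρ, ρ', hρ⟩ := (hbr i).deriv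
    exact ⟨ρ, ρ', fun t ht => hρ t (h ht)⟩
  have hRb : ∀ i x, ∀ t ∈ Icc (l i) (r i), ‖∫ s in (l i)..t, F (line q x s)‖ ≤ R := by
    intro i x t ht
    have h0 : (0 : ℝ) ≤ (2 + D) * β ^ n := by positivity
    refine (norm_integral_le_of_cuts (hGi x) (a := l i) (b := r i) h0 (B i)
      (fun u v hu huv hv hc => ?_) le_rfl ht.1 ht.2).trans ?_
    · have hsub : Ioo u v ⊆ Ioo (l i) (r i) := Ioo_subset_Ioo hu hv
      have hd := hmono i u v hsub
      have hcell := hB i u v hsub hc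
      -- `HasInvDerivBound.sub_le` compares points of the open interval, so it is applied to
      -- slightly smaller intervals.
      have hlen : v - u ≤ β ^ n := by
        refine le_of_forall_lt fun c hc => ?_
        rcases lt_or_ge c 0 with h | h
        · exact h.trans (by positivity)
        have e : 0 < (v - u - c) / 4 := by linarith
        have := hd.sub_le ordConnected_Ioo (extIter_mem τ n)
          (u := u + (v - u - c) / 4) (v := v - (v - u - c) / 4)
          ⟨by linarith, by linarith⟩ ⟨by linarith, by linarith⟩ (by linarith)
        linarith
      refine (norm_integral_pathFunction_cell_le pstar a hτ hδ hδε hε hJ hg hφ p q x huv hD hd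
        hcell).trans ?_
      nlinarith
    · rw [hR]
      gcongr
      exact_mod_cast hBcard' i
  -- Means over whole branches: the inverse lengths depend on `τ` and `n` only, which is where
  -- uniformity in `ε` and `δ` is secured.
  let avg : ι → Config d → ℂ := fun i x =>
    (((r i - l i)⁻¹ : ℝ) : ℂ) * ∫ s in (l i)..(r i), F (line q x s)
  have havgl : ∀ i x t, avg i (line q x t) = avg i x := fun i x t => by
    simp only [avg, line_line]
  have havgm : ∀ i, Measurable (avg i) := fun i =>
    (measurable_integral_line q hF (l i) measurable_const fun _ => (hlr i).le).const_mul _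
  have havgb : ∀ i x, ‖avg i x‖ ≤ (r i - l i)⁻¹ * R := fun i x => by
    have h0 : 0 ≤ (r i - l i)⁻¹ := inv_nonneg.2 (sub_nonneg.2 (hlr i).le)
    simp only [avg]
    rw [norm_mul, Complex.norm_real, Real.norm_of_nonneg h0]
    exact mul_le_mul_of_nonneg_left (hRb i x _ (right_mem_Icc.2 (hlr i).le)) h0
  let P : Config d → ℂ := fun x => ∑ i, (Ioo (l i) (r i)).indicator (fun _ => avg i x) (x q : ℝ)
  have hqm : Measurable fun x : Config d => (x q : ℝ) :=
    measurable_subtype_coe.comp (measurable_pi_apply q)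
  have hPm : Measurable P := Finset.measurable_fun_sum _ fun i _ => by
    have : Measurable (((fun x : Config d => (x q : ℝ)) ⁻¹' Ioo (l i) (r i)).indicator (avg i)) :=
      (havgm i).indicator (hqm measurableSet_Ioo)
    exact this
  have hPb : ∀ x, ‖P x‖ ≤ (∑ i, (r i - l i)⁻¹) * R := fun x => by
    rw [Finset.sum_mul]
    refine (norm_sum_le _ _).trans (Finset.sum_le_sum fun i _ => ?_)
    exact (norm_indicator_le_norm_self (fun _ => avg i x) _).trans (havgb i x)
  have hPl : ∀ x, ∀ s ∈ Icc (0 : ℝ) 1, P (line q x s) =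
      ∑ i, (Ioo (l i) (r i)).indicator (fun _ => avg i x) s := fun x s hs => by
    simp only [P, havgl, line_apply_self q x hs]
  have hFi := integrable_of_norm_le μ.variation hF hC
  have hPi := integrable_of_norm_le μ.variation hPm hPb
  have hmain : ‖pair μ (fun x => F x - P x)‖ ≤ 2 * R * (strongNorm μ).toReal := by
    refine norm_pair_le_of_norm_integral_line_le hμ q (hF.sub hPm)
      (C := C + (∑ i, (r i - l i)⁻¹) * R)
      (fun x => (norm_sub_le _ _).trans (add_le_add (hC x) (hPb x))) (by positivity)
      (fun x t ht => ?_) ?_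
    · have e : ∫ s in 0..t, (F (line q x s) - P (line q x s)) = ∫ s in 0..t, (F (line q x s) -
          ∑ i, (Ioo (l i) (r i)).indicator (fun _ => avg i x) s) := by
        refine intervalIntegral.integral_congr fun s hs => ?_
        rw [uIcc_of_le ht.1] at hs
        rw [hPl x s ⟨hs.1, hs.2.trans ht.2⟩]
      refine (congrArg norm e).trans_le ?_
      exact norm_integral_sub_averages_le hl hlr hdisj hfin (hGi x) hR0.le
        (fun i => hRb i x) ht
    -- Along the line, discontinuities can occur only at the cuts and outside the branches. These
    -- are finitely many values of `x q`, chosen independently of the other coordinates, hence a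
    -- null set.
    · filter_upwards [ae_apply_notMem hμ q
        (hfin.union (Set.finite_iUnion fun i => (B i).finite_toSet))] with x hx
      have hxI : (x q : ℝ) ∈ Icc (0 : ℝ) 1 := (x q).2
      obtain ⟨i, hi⟩ : ∃ i, (x q : ℝ) ∈ Ioo (l i) (r i) := by
        by_contra hcon
        exact hx (Or.inl ⟨hxI, fun h => hcon (mem_iUnion.1 h)⟩)
      have hnB : (x q : ℝ) ∉ (B i : Set ℝ) := fun h => hx (Or.inr (mem_iUnion.2 ⟨i, h⟩))
      have hnhds : Ioo (l i) (r i) \ (B i : Set ℝ) ∈ nhds (x q : ℝ) :=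
        (isOpen_Ioo.sdiff (B i).finite_toSet.isClosed).mem_nhds ⟨hi, hnB⟩
      obtain ⟨u, v, huv, hsub⟩ := mem_nhds_iff_exists_Ioo_subset.1 hnhds
      have hsub' : Ioo u v ⊆ Ioo (l i) (r i) := hsub.trans sdiff_subset
      have hcell := hB i u v hsub' fun c hc hcI => (hsub hcI).2 hc
      refine (continuousOn_pathFunction_line pstar a hδ hδε hε hφ.1 p q x (hmono i u v hsub')
        hcell _ huv).sub ?_
      refine (continuousAt_const (y := avg i x)).congr ?_
      filter_upwards [Ioo_mem_nhds hi.1 hi.2] with s hs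
      rw [hPl x s (Ioo_subset_Icc_self ((hbr i).subset hs)),
        Finset.sum_eq_single i (fun j _ hji => indicator_of_notMem (fun hsj =>
          Set.disjoint_left.1 (hdisj hji) hsj hs) _) (by simp), indicator_of_mem hs]
  have hweak : ‖pair μ P‖ ≤ (∑ i, (r i - l i)⁻¹) * R * (weakNorm μ).toReal := by
    refine norm_pair_le_weakNorm μ hPm ?_ hPb
    exact mul_nonneg (Finset.sum_nonneg fun i _ => inv_nonneg.2 (sub_nonneg.2 (hlr i).le)) hR0.le
  calc ‖pair μ F‖ = ‖pair μ (fun x => F x - P x) + pair μ P‖ := by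
        rw [pair_sub hFi hPi]; congr 1; ring
    _ ≤ _ := norm_add_le _ _
    _ ≤ _ := add_le_add hmain hweak
    _ = _ := by ring

end PathFunction

/-! ### The inequality for one iterate, and its iteration. -/

/-- Empty branches are dropped, because the estimates use the reciprocals of the branch lengths. -/
theorem IsPiecewiseExpanding.exists_interval_branches {τ : unitInterval → unitInterval}
    (hτ : IsPiecewiseExpanding τ) :
    ∃ β D : ℝ, 0 < β ∧ β < 1 ∧ 0 ≤ D ∧ ∀ n, ∃ (ι : Type) (_ : Fintype ι) (l r : ι → ℝ),
      (∀ i, 0 ≤ l i) ∧ (∀ i, l i < r i) ∧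
      Pairwise (Function.onFun Disjoint fun i => Ioo (l i) (r i)) ∧
      (Icc (0 : ℝ) 1 \ ⋃ i, Ioo (l i) (r i)).Finite ∧
      ∀ i, IsBranch τ β D n (Ioo (l i) (r i)) := by
  classical
  obtain ⟨β, D, hβ0, hβ1, hD, h⟩ := hτ.exists_branches
  refine ⟨β, D, hβ0, hβ1, hD, fun n => ?_⟩
  obtain ⟨ι, _, K, hdisj, hfin, hK⟩ := h n
  choose l r hlr hl0 _ he using fun i : {i // (K i).Nonempty} => (hK i).exists_eq_Ioo i.2
  refine ⟨{i // (K i).Nonempty}, inferInstance, l, r, hl0, hlr, ?_, ?_, ?_⟩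
  · intro i j hij
    simp only [Function.onFun, ← he]
    exact hdisj fun h => hij (Subtype.ext h)
  · refine hfin.subset ?_
    rintro t ⟨ht, htn⟩
    refine ⟨ht, fun hmem => htn ?_⟩
    obtain ⟨i, hi⟩ := mem_iUnion.1 hmem
    exact mem_iUnion.2 ⟨⟨i, t, hi⟩, he ⟨i, t, hi⟩ ▸ hi⟩
  · intro i
    rw [← he]
    exact hK i

theorem tendsto_pow_mul_affine_mul_pow (d c : ℕ) {β : ℝ} (hβ0 : 0 < β) (hβ1 : β < 1) :
    Filter.Tendsto (fun n : ℕ => (2 * (n : ℝ) + 1) ^ d * ((n : ℝ) * c + 1) * β ^ n)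
      Filter.atTop (nhds 0) := by
  have h := (tendsto_pow_const_mul_const_pow_of_lt_one (d + 1) hβ0.le hβ1).const_mul
    (3 ^ d * ((c : ℝ) + 1))
  rw [mul_zero] at h
  refine squeeze_zero' (Filter.Eventually.of_forall fun n => by positivity) ?_ h
  filter_upwards [Filter.eventually_ge_atTop 1] with n hn
  have hn1 : (1 : ℝ) ≤ n := by exact_mod_cast hn
  calc (2 * (n : ℝ) + 1) ^ d * ((n : ℝ) * c + 1) * β ^ n
      ≤ (3 * (n : ℝ)) ^ d * ((n : ℝ) * c + n) * β ^ n := by gcongr; linarith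
    _ = _ := by ring

/-- Lasota–Yorke inequality for a fixed iterate, with a coefficient of the strong norm which tends
to zero. -/
theorem exists_strongNorm_iterate_transfer_le {d m : ℕ} {τ : unitInterval → unitInterval}
    (hτ : IsPiecewiseExpanding τ) (A : CollisionIntervals d) (pstar : Site d)
    (Λ : Finset (Site d)) (a : Fin m → ℝ) :
    ∃ κ C : ℕ → ℝ, (∀ n, 0 ≤ κ n) ∧ (∀ n, 0 ≤ C n) ∧
      Filter.Tendsto κ Filter.atTop (nhds 0) ∧
      ∀ (n : ℕ) (ε δ : ℝ), 0 < δ → δ ≤ ε → ε ≤ A.ε₀ → ∀ J : Fin m → Λ → Set unitInterval,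
        (∀ i q, (J i q).OrdConnected) → (∀ x, |localWeight a J x| ≤ 1) → ∀ μ ∈ bvMeasures d,
        strongNorm ((transfer (coupledMap τ A pstar ε δ) (localWeight a J))^[n] μ) ≤
          ENNReal.ofReal (κ n * (strongNorm μ).toReal + C n * (weakNorm μ).toReal) := by
  classical
  obtain ⟨β, D, hβ0, hβ1, hD, hbr⟩ := hτ.exists_interval_branches
  choose ι hι l r hl hlr hdisj hfin hK using hbr
  set R : ℕ → ℝ := fun n =>
    (((n * (4 * d + m * Λ.card) * 2 : ℕ) : ℝ) + 1) * ((2 + D) * β ^ n) with hR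
  have hR0 : ∀ n, 0 ≤ R n := fun n => by positivity
  refine ⟨fun n => (2 * (n : ℝ) + 1) ^ d * (R n * 2),
    fun n => (2 * (n : ℝ) + 1) ^ d * (R n * ∑ i, (r n i - l n i)⁻¹),
    fun n => mul_nonneg (by positivity) (mul_nonneg (hR0 n) zero_le_two),
    fun n => mul_nonneg (by positivity) (mul_nonneg (hR0 n) (Finset.sum_nonneg fun i _ =>
      inv_nonneg.2 (sub_nonneg.2 (hlr n i).le))), ?_, ?_⟩
  · have h := (tendsto_pow_mul_affine_mul_pow d ((4 * d + m * Λ.card) * 2) hβ0 hβ1).const_mul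
      ((2 + D) * 2)
    rw [mul_zero] at h
    refine h.congr fun n => ?_
    simp only [hR]
    push_cast
    ring
  · intro n ε δ hδ hδε hε J hJ hg μ hμ
    have := isFiniteMeasure_variation μ
    have hT := measurable_coupledMap hτ A pstar hδ hδε hε
    refine iSup_le fun p => iSup₂_le fun φ hφ => ?_
    rw [← ofReal_norm]
    refine ENNReal.ofReal_le_ofReal ?_
    obtain ⟨C, hC⟩ := exists_norm_partialDeriv_le hφ.1 p
    rw [pair_iterate_transfer hT (measurable_localWeight hJ) hg n μ (hφ.1.2.2 p).2.measurable hC]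
    set S := Finset.Icc (fun i => p i - (n : ℤ)) (fun i => p i + n) with hS
    have e : pair μ (fun x => partialDeriv p φ ((coupledMap τ A pstar ε δ)^[n] x) *
        (orbitWeight (coupledMap τ A pstar ε δ) (localWeight a J) n x : ℂ)) =
        ∑ q ∈ S, pair μ (pathFunction pstar a τ A ε δ J φ n p q) := by
      rw [← funext (sum_pathFunction pstar a φ n p)]
      exact VectorMeasure.integral_finsetSum S fun q _ => integrable_of_norm_le _
        (measurable_pathFunction pstar a hτ hδ hδε hε hJ hφ.1 n p q)
        (norm_pathFunction_le pstar a hg hC n q)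
    rw [e]
    refine (norm_sum_le _ _).trans ((Finset.sum_le_card_nsmul _ _ _ fun q _ =>
      norm_pair_pathFunction_le pstar a hτ hδ hδε hε hJ hg hβ0 hD (hl n) (hlr n) (hdisj n) (hfin n)
        (hK n) hφ p q hμ).trans_eq ?_)
    rw [card_Icc_sub_add, nsmul_eq_mul]
    simp only [hR]
    push_cast
    ring

/-- Iteration of a Lasota–Yorke inequality. -/
theorem exists_iterate_bound {κ C : ℕ → ℝ} (hκ : ∀ n, 0 ≤ κ n) (hC : ∀ n, 0 ≤ C n)
    (hlim : Filter.Tendsto κ Filter.atTop (nhds 0)) :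
    ∃ σ C' : ℝ, 0 < σ ∧ σ < 1 ∧ 0 < C' ∧ ∀ (S : ℕ → ℝ) (W : ℝ), (∀ n, 0 ≤ S n) → 0 ≤ W →
      (∀ n k, S (n + k) ≤ κ n * S k + C n * W) → ∀ n, S n ≤ C' * σ ^ n * S 0 + C' * W := by
  obtain ⟨N, hN1, hN⟩ := ((Filter.eventually_ge_atTop 1).and
    (hlim.eventually (gt_mem_nhds (show (0 : ℝ) < 1 / 2 by norm_num)))).exists
  have hN0 : N ≠ 0 := by omega
  -- Chosen so that `σ ^ N = 1 / 2`, the factor gained in each block of `N` steps.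
  set σ : ℝ := (1 / 2 : ℝ) ^ ((N : ℝ)⁻¹) with hσ
  have hσN : σ ^ N = 1 / 2 := Real.rpow_inv_natCast_pow (by norm_num) hN0
  have hσ0 : 0 < σ := Real.rpow_pos_of_pos (by norm_num) _
  have hσ1 : σ < 1 := Real.rpow_lt_one (by norm_num) (by norm_num)
    (inv_pos.2 (by exact_mod_cast hN1))
  set K : ℝ := ∑ j ∈ Finset.range N, κ j with hK
  set E : ℝ := ∑ j ∈ Finset.range N, C j with hE
  have hK0 : 0 ≤ K := Finset.sum_nonneg fun j _ => hκ j
  have hE0 : 0 ≤ E := Finset.sum_nonneg fun j _ => hC j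
  have hCN := hC N
  -- The summand 1 only makes the constant positive.
  refine ⟨σ, 2 * K + 2 * K * C N + E + 1, hσ0, hσ1, by positivity, fun S W hS hW h n => ?_⟩
  -- The weak terms of successive blocks form a geometric series of ratio `1 / 2`, whence `2 * C N`.
  have hblock : ∀ k, S (N * k) ≤ (1 / 2) ^ k * S 0 + 2 * C N * W := by
    intro k
    induction k with
    | zero => simpa using by positivity
    | succ k ih =>
      have h1 := h N (N * k)
      have h2 : κ N * S (N * k) ≤ 1 / 2 * S (N * k) := mul_le_mul_of_nonneg_right hN.le (hS _)
      rw [show N * (k + 1) = N + N * k by ring, pow_succ]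
      linarith
  have hj : n % N < N := Nat.mod_lt _ (by omega)
  have h1 := h (n % N) (N * (n / N))
  rw [Nat.mod_add_div] at h1
  have hκK : κ (n % N) ≤ K := Finset.single_le_sum (f := κ) (fun j _ => hκ j) (Finset.mem_range.2 hj)
  have hCE : C (n % N) ≤ E := Finset.single_le_sum (f := C) (fun j _ => hC j) (Finset.mem_range.2 hj)
  -- The incomplete block has fewer than `N` steps and costs at most a factor 2.
  have hpow : (1 / 2 : ℝ) ^ (n / N) ≤ 2 * σ ^ n := by
    have e : σ ^ n = σ ^ (n % N) * (1 / 2) ^ (n / N) := by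
      rw [← hσN, ← pow_mul, ← pow_add, Nat.mod_add_div]
    have h3 : (1 / 2 : ℝ) ≤ σ ^ (n % N) := by
      rw [← hσN]
      exact pow_le_pow_of_le_one hσ0.le hσ1.le hj.le
    have h4 : (0 : ℝ) < (1 / 2) ^ (n / N) := by positivity
    rw [e]
    nlinarith
  have hS0 := hS 0
  calc S n ≤ κ (n % N) * S (N * (n / N)) + C (n % N) * W := h1
    _ ≤ K * ((1 / 2) ^ (n / N) * S 0 + 2 * C N * W) + E * W := by
        gcongr
        · exact hS _
        · exact hblock _
    _ ≤ K * (2 * σ ^ n * S 0 + 2 * C N * W) + E * W := by gcongr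
    _ = (2 * K) * σ ^ n * S 0 + (2 * K * C N + E) * W := by ring
    _ ≤ _ := by
        have h5 := mul_nonneg hK0 hCN
        exact add_le_add (mul_le_mul_of_nonneg_right
          (mul_le_mul_of_nonneg_right (by linarith) (pow_nonneg hσ0.le n)) hS0)
          (mul_le_mul_of_nonneg_right (by linarith) hW)

end CoupledLattice
end

theorem mainTheorem4 (d : ℕ) (τ : unitInterval → unitInterval) (hτ : IsPiecewiseExpanding τ)
    (A : CollisionIntervals d) (pstar : Site d)
    (Λ : Finset (Site d)) (s : ℕ) (a : Fin (s + 1) → ℝ)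
    (ha : ∀ i, |a i| ≤ 1) (ha₀ : a 0 = 0 ∨ a 0 = 1)
    (J : ℝ → Fin (s + 1) → Λ → Set unitInterval)
    (hJ : ∀ δ, 0 < δ → δ ≤ A.ε₀ → ∀ i q, (J δ i q).OrdConnected)
    (hbound : ∀ δ, 0 < δ → δ ≤ A.ε₀ → ∀ y, |stepFunction a (J δ) y| ≤ 1)
    (hgrow : ∀ δ' δ, 0 < δ' → δ' ≤ δ → δ ≤ A.ε₀ →
      {y | stepFunction a (J δ) y = a 0} ⊆ {y | stepFunction a (J δ') y = a 0})
    (hshrink : ∀ δ' δ, 0 < δ' → δ' ≤ δ → δ ≤ A.ε₀ → ∀ i, a i ≠ a 0 →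
      {y | stepFunction a (J δ') y = a i} ⊆ {y | stepFunction a (J δ) y = a i}) :
    ∃ σ C : ℝ, 0 < σ ∧ σ < 1 ∧ 0 < C ∧
      ∀ ε δ : ℝ, 0 < δ → δ ≤ ε → ε ≤ A.ε₀ →
        ∀ (n : ℕ), ∀ μ ∈ bvMeasures d,
          strongNorm ((transfer (coupledMap τ A pstar ε δ) (localWeight a (J δ)))^[n] μ) ≤
            ENNReal.ofReal (C * σ ^ n) * strongNorm μ + ENNReal.ofReal C * weakNorm μ := by
  obtain ⟨κ, C, hκ, hC, hlim, hLY⟩ := exists_strongNorm_iterate_transfer_le hτ A pstar Λ a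
  obtain ⟨σ, C', hσ0, hσ1, hC'0, hiter⟩ := exists_iterate_bound hκ hC hlim
  refine ⟨σ, C', hσ0, hσ1, hC'0, fun ε δ hδ hδε hε n μ hμ => ?_⟩
  have hδ' : δ ≤ A.ε₀ := hδε.trans hε
  have hg : ∀ x, |localWeight a (J δ) x| ≤ 1 := fun x => hbound δ hδ hδ' _
  have hJδ := hJ δ hδ hδ'
  have hT := measurable_coupledMap hτ A pstar hδ hδε hε
  set L := transfer (coupledMap τ A pstar ε δ) (localWeight a (J δ)) with hL
  -- The inequality for a fixed iterate is applied at every `L^[j] μ`, so these must have finite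
  -- strong norm; the same inequality, started at `μ`, shows it.
  have hbv : ∀ k, L^[k] μ ∈ bvMeasures d := fun k =>
    (hLY k ε δ hδ hδε hε (J δ) hJδ hg μ hμ).trans_lt ENNReal.ofReal_lt_top
  have key := hiter (fun k => (strongNorm (L^[k] μ)).toReal) (weakNorm μ).toReal
    (fun _ => ENNReal.toReal_nonneg) ENNReal.toReal_nonneg (fun k j => by
      have h1 := hLY k ε δ hδ hδε hε (J δ) hJδ hg _ (hbv j)
      rw [← hL, ← Function.iterate_add_apply] at h1
      have h2 : (weakNorm (L^[j] μ)).toReal ≤ (weakNorm μ).toReal :=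
        ENNReal.toReal_mono (weakNorm_lt_top μ).ne
          (weakNorm_iterate_transfer_le hT (measurable_localWeight hJδ) hg j μ)
      refine (ENNReal.toReal_le_of_le_ofReal (add_nonneg
        (mul_nonneg (hκ k) ENNReal.toReal_nonneg) (mul_nonneg (hC k) ENNReal.toReal_nonneg))
        h1).trans ?_
      exact add_le_add_right (mul_le_mul_of_nonneg_left h2 (hC k)) _) n
  have hσn : 0 ≤ C' * σ ^ n := by positivity
  calc strongNorm (L^[n] μ) = ENNReal.ofReal (strongNorm (L^[n] μ)).toReal :=
        (ENNReal.ofReal_toReal (ne_of_lt (hbv n))).symm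
    _ ≤ ENNReal.ofReal (C' * σ ^ n * (strongNorm μ).toReal + C' * (weakNorm μ).toReal) :=
        ENNReal.ofReal_le_ofReal key
    _ = _ := by
        rw [ENNReal.ofReal_add (mul_nonneg hσn ENNReal.toReal_nonneg)
          (mul_nonneg hC'0.le ENNReal.toReal_nonneg), ENNReal.ofReal_mul hσn,
          ENNReal.ofReal_mul (q := (weakNorm μ).toReal) hC'0.le, ENNReal.ofReal_toReal (ne_of_lt hμ),
          ENNReal.ofReal_toReal (weakNorm_lt_top μ).ne]
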